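/- **Lie algebras and parabolics.** Work over $\mathbb C$. Let $J_N$ be the $N\times N$ matrix with ones on the skew diagonal and zeros elsewhere. Let $\mathfrak{so}_N=\{A: A^TJ_N+J_NA=0\}$ and $\mathfrak{sp}_{2n}=\{A: A^T\Omega+\Omega A=0\}$, where $\Omega=\begin{bmatrix}0&J_n\\-J_n&0\end{bmatrix}$. Let $d$ be a palindromic vector of positive integers with sum $N$ ($N=2n$ for $\mathfrak{sp}_{2n}$), of the form $(d_1,\dots,d_r,d_r,\dots,d_1)$ (type (a)) or $(d_1,\dots,d_r,d_{r+1},d_r,\dots,d_1)$ (type (b)). For $\mathfrak g=\mathfrak{sp}_{2n}$ or $\mathfrak{so}_N$ let $\mathfrak p(d)$, $\mathfrak m$, $\mathfrak n$ be the sets of block upper triangular, block diagonal and strictly block upper triangular matrices in $\mathfrak g$, with diagonal blocks of sizes $d$. An element $X\in\mathfrak n$ is a *Richardson element* for $\mathfrak p(d)$ if $[\mathfrak p(d),X]=\mathfrak n$. **Simple parabolics.** $\mathfrak p(d)$ is *simple* in the following cases. 1. $\mathfrak{sp}_{2n}$, type (a). 2. $\mathfrak{so}_{2n}$, type (a), if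 every odd block length appears exactly twice in $d$. 3. $\mathfrak{sp}_{2n}$, type (b), if every odd $d_i<d_{r+1}$ appears exactly twice in $d$. 4. $\mathfrak{so}_N$, type (b), if for some $0\le k\le r$ the numbers $d_1,\dots,d_k$ are even, $d_{k+1},\dots,d_r$ are odd, every even $d_i$ ($i\le k$) is smaller than each of $d_{k+1},\dots,d_r$, the even $d_i>d_{r+1}$ occur only once among $d_1,\dots,d_k$, and $d_{r+1}$ is odd unless $k=r$ (if $k=r$, its parity is arbitrary). **Diagrams.** A diagram is a set of lines on the vertices $1,\dots,N$. The vertices are arranged in columns of lengths given by $d$ and labelled consecutively column by column, top to bottom in the first $r$ columns (the *left* columns) and in the central column (type (b)). Write $k^*=N+1-k$. The counterpart of a line $i$—$j$ is $j^*$—$i^*$. All diagrams contain the counterparts of all their lines; "joining a sequence" means drawing a line between any two successive vertices. *$L_{even}(d)$ (type (a)).* Top-adjust the left columns, and in each row join its vertices from left to right; add counterparts. Let $e_\rho$ be the last vertex of row $\rho$ of the left half. * For $\mathfrak{sp}_{2n}$ add $e_\rho$—$e_\rho^*$ for all non-empty rows $\rho$. * For $\mathfrak{so}_{2n}$ add $e_{2l-1}$—$e_{2l}^*$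 and $e_{2l}$—$e_{2l-1}^*$ for all $l\geq 1$ such that rows $2l-1$ and $2l$ are both non-empty. *$L_{odd}(d)$ for $\mathfrak{sp}_{2n}$ (type (b)).* Proceed in rounds; after each round delete the topmost and the lowest remaining vertex of every column, until no vertices are left. In one round let $T$ be the sequence, from left to right, of the topmost remaining vertices of the non-exhausted left columns, and $B$ the sequence of the lowest remaining vertices of the left columns with at least two remaining vertices. Join the sequence $T$ and join the sequence $B$. Let $t,b$ be the last vertices of $T,B$; below, a line with an undefined end is omitted. * If the central column is not exhausted (it then has at least two remaining vertices), join $t$ to its topmost and $b$ to its lowest remaining vertex. * If it is exhausted and no left column has exactly one remaining vertex, add $t$—$b^*$ and $b$—$t^*$. * If it is exhausted and some left column has exactly one remaining vertex, add $t$—$t^*$ and $b$—$b^*$. Add all counterparts. *$L_{odd}(d)$ for $\mathfrak{so}_N$ (type (b)).* If $d_{r+1}$ is odd, first choose a sequence $S$ of vertices in left columns, from left to right. If no even $d_i$, $i\le r$, exceeds $d_{r+1}$, $S$ consists of the middle vertices of the left columns of odd length. Otherwise $S$ consists of the vertices in row $(d_{r+1}+1)/2$ of the left columns longer than $d_{r+1}$.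 Join the sequence $S$, join its last vertex to the middle vertex of the central column, add the counterparts, and remove from consideration the vertices of $S$, their images under ${}^*$ and the middle vertex of the central column. (If $d_{r+1}$ is even, skip this step.) On the remaining vertices proceed in rounds with $T,B,t,b$ as above: join $T$ and $B$; if the central column is not exhausted, join $t$ to its topmost and $b$ to its lowest remaining vertex; if it is exhausted, add $t$—$b^*$ and $b$—$t^*$ (no such line if $B$ is empty). Add all counterparts. **Theorem.** Let $\mathfrak p(d)$ be a simple parabolic subalgebra of $\mathfrak g=\mathfrak{sp}_{2n}$ or $\mathfrak{so}_N$. With the sums over all lines $i$—$j$, $i<j$, of $L_{even}(d)$ in type (a), resp. $L_{odd}(d)$ in type (b), put $$X(d)=\sum_{i\le n}E_{ij}-\sum_{i>n}E_{ij}\ \text{ for }\mathfrak{sp}_{2n},\qquad X(d)=\sum_{i+j\le N}E_{ij}-\sum_{i+j>N}E_{ij}\ \text{ for }\mathfrak{so}_N .$$ Then $X(d)$ is a Richardson element for $\mathfrak p(d)$, and $\dim\mathfrak g^{X(d)}=\dim\mathfrak m$, where $\mathfrak g^{X}=\{A\in\mathfrak g:[A,X]=0\}$. -/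

import Mathlib

namespace LineDiagram

attribute [local instance 100] LieRing.ofAssociativeRing

/-! ## Classical Lie algebras, standard parabolic subalgebras, Richardson elements -/

/-- The two families of classical Lie algebras considered: symplectic and orthogonal. -/
inductive Family
  | sp
  | so

/-- The matrix of the bilinear form on `ℂ^N`. Orthogonal: ones on the skew diagonal.
Symplectic (with `N = 2n`): the skew diagonal carries `1` in the first `n` rows and `-1` in the
last `n` rows. -/
def formMatrix (τ : Family) (N : ℕ) : Matrix (Fin N) (Fin N) ℂ :=
  Matrix.of fun a b =>
    if b = a.rev then
      (match τ with
        | .sp => if a.val < N / 2 then 1 else -1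
        | .so => 1)
    else 0

/-- The Lie algebra `sp_N` (for even `N`) resp. `so_N`: all `A` with `Aᵀ J + J A = 0`, where `J` is
the matrix of the form. -/
def classicalLie (τ : Family) (N : ℕ) : LieSubalgebra ℂ (Matrix (Fin N) (Fin N) ℂ) :=
  skewAdjointMatricesLieSubalgebra (formMatrix τ N)

/-- The number (from `0`) of the block of sizes `d = (d₁, d₂, …)` that contains the position `a`
(counted from `0`). -/
def blockIndex : List ℕ → ℕ → ℕ
  | [], _ => 0
  | x :: d, a => if a < x then 0 else blockIndex d (a - x) + 1

/-- The block number of a row or column index. -/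
def block (d : List ℕ) (a : Fin d.sum) : ℕ := blockIndex d a.val

/-- The standard parabolic subalgebra `p(d)`: the block upper triangular matrices in the Lie
algebra, with diagonal blocks of sizes `d`. -/
def parabolic (τ : Family) (d : List ℕ) :
    LieSubalgebra ℂ (Matrix (Fin d.sum) (Fin d.sum) ℂ) where
  carrier := {A | A ∈ classicalLie τ d.sum ∧ A.BlockTriangular (block d)}
  zero_mem' := ⟨zero_mem _, Matrix.blockTriangular_zero⟩
  add_mem' := fun hA hB => ⟨add_mem hA.1 hB.1, hA.2.add hB.2⟩
  smul_mem' := fun c A hA => ⟨(classicalLie τ d.sum).smul_mem c hA.1, fun a b h => by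
    simp [hA.2 h]⟩
  lie_mem' := fun {A B} hA hB => by
    refine ⟨(classicalLie τ d.sum).lie_mem hA.1 hB.1, ?_⟩
    rw [Ring.lie_def]
    exact (hA.2.mul hB.2).sub (hB.2.mul hA.2)

/-- The nilradical `n` of `p(d)`: its strictly block upper triangular matrices. -/
def nilradical (τ : Family) (d : List ℕ) :
    Submodule ℂ (Matrix (Fin d.sum) (Fin d.sum) ℂ) where
  carrier := {A | A ∈ classicalLie τ d.sum ∧ ∀ a b, block d b ≤ block d a → A a b = 0}
  zero_mem' := ⟨zero_mem _, fun _ _ _ => rfl⟩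
  add_mem' := fun hA hB => ⟨add_mem hA.1 hB.1, fun a b h => by
    simp [hA.2 a b h, hB.2 a b h]⟩
  smul_mem' := fun c A hA => ⟨(classicalLie τ d.sum).smul_mem c hA.1, fun a b h => by
    simp [hA.2 a b h]⟩

/-- The standard Levi factor `m` of `p(d)`: its block diagonal matrices. -/
def leviFactor (τ : Family) (d : List ℕ) :
    Submodule ℂ (Matrix (Fin d.sum) (Fin d.sum) ℂ) where
  carrier := {A | A ∈ classicalLie τ d.sum ∧ ∀ a b, block d a ≠ block d b → A a b = 0}
  zero_mem' := ⟨zero_mem _, fun _ _ _ => rfl⟩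
  add_mem' := fun hA hB => ⟨add_mem hA.1 hB.1, fun a b h => by
    simp [hA.2 a b h, hB.2 a b h]⟩
  smul_mem' := fun c A hA => ⟨(classicalLie τ d.sum).smul_mem c hA.1, fun a b h => by
    simp [hA.2 a b h]⟩

/-- The centralizer `g^X` of a matrix `X` in the Lie algebra `g`. -/
def centralizer (τ : Family) {N : ℕ} (X : Matrix (Fin N) (Fin N) ℂ) :
    Submodule ℂ (Matrix (Fin N) (Fin N) ℂ) where
  carrier := {A | A ∈ classicalLie τ N ∧ ⁅A, X⁆ = 0}
  zero_mem' := ⟨zero_mem _, zero_lie X⟩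
  add_mem' := fun hA hB => ⟨add_mem hA.1 hB.1, by rw [add_lie, hA.2, hB.2, add_zero]⟩
  smul_mem' := fun c A hA => ⟨(classicalLie τ N).smul_mem c hA.1, by
    rw [smul_lie, hA.2, smul_zero]⟩

/-- `X` is a Richardson element for `p(d) = m ⊕ n`: `X ∈ n` and `[p(d), X] = n`. -/
def IsRichardson (τ : Family) (d : List ℕ) (X : Matrix (Fin d.sum) (Fin d.sum) ℂ) : Prop :=
  X ∈ nilradical τ d ∧
    {Y | ∃ A ∈ parabolic τ d, ⁅A, X⁆ = Y} =
      (nilradical τ d : Set (Matrix (Fin d.sum) (Fin d.sum) ℂ))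

/-! ## Palindromic dimension vectors and simple parabolic subalgebras

A palindromic dimension vector is given by its left half `l = (d₁, …, d_r)` and its central entry:
`none` for `(d₁, …, d_r, d_r, …, d₁)` (type (a)), and `some c` for
`(d₁, …, d_r, c, d_r, …, d₁)` (type (b)). -/

/-- The dimension vector with left half `l` and central entry `c`. -/
def dimVector (l : List ℕ) (c : Option ℕ) : List ℕ := l ++ c.toList ++ l.reverse

/-- The condition that the parabolic subalgebra of the given dimension vector is simple:
* `sp`, type (a): no condition;
* `so`, type (a): odd block lengths appear exactly twice;
* `sp`, type (b): each odd block length smaller than `c` appears exactly twice (and `c` is even,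
  as the size of the matrices is);
* `so`, type (b): the left half consists of even lengths `e` followed by odd lengths `o`, the even
  ones smaller than these odd ones; an even length larger than `c` appears only once in `e`;
  and `c` is odd as well, unless there are no odd lengths on the left. -/
def IsSimple : Family → List ℕ → Option ℕ → Prop
  | .sp, _, none => True
  | .so, l, none =>
      ∀ x ∈ dimVector l none, Odd x → (dimVector l none).count x = 2
  | .sp, l, some c =>
      Even c ∧ ∀ x ∈ dimVector l (some c), Odd x → x < c → (dimVector l (some c)).count x = 2
  | .so, l, some c =>
      ∃ e o : List ℕ, l = e ++ o ∧ (∀ x ∈ e, Even x) ∧ (∀ x ∈ o, Odd x) ∧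
        (∀ x ∈ e, ∀ y ∈ o, x < y) ∧ (∀ x ∈ e, c < x → e.count x = 1) ∧ (Odd c ∨ o = [])

/-! ## Line diagrams

Vertices carry the labels `1, …, N`. A diagram is given by its chains: a chain is the increasing
list of the labels of vertices joined successively by lines (a list with at most one entry
contributes no line). -/

/-- Columns of the given lengths, labelled consecutively from `s`, from top to bottom. -/
def columns : ℕ → List ℕ → List (List ℕ)
  | _, [] => []
  | s, x :: l => List.range' s x :: columns (s + x) l

/-- The vertices in row `k` (counted from `0`) of top-adjusted columns, from left to right. -/
def row (C : List (List ℕ)) (k : ℕ) : List ℕ := C.filterMap fun v => v[k]?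

/-- The sequence of mirror images `k ↦ N + 1 - k` of a sequence of vertices, in reverse order; a
line `i — j` of the sequence becomes its counterpart `(N + 1 - j) — (N + 1 - i)`. -/
def mirror (N : ℕ) (S : List ℕ) : List ℕ := S.reverse.map fun k => N + 1 - k

/-- `L_even(d)`, symplectic case, `N = 2n`: the horizontal rows in the left half and their
counterparts, joined through the lines `k — (2n + 1 - k)` at the last vertex `k` of each row of the
left half. -/
def evenSp (l : List ℕ) : List (List ℕ) :=
  let N := 2 * l.sum
  (List.range N).map fun k => row (columns 1 l) k ++ mirror N (row (columns 1 l) k)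

/-- `L_even(d)`, orthogonal case, `N = 2n`: the horizontal rows in the left half and their
counterparts; the rows are taken in pairs from the top, and the last vertex of each row of a pair
is joined to the mirror image of the last vertex of the other one (if both rows are non-empty). -/
def evenSo (l : List ℕ) : List (List ℕ) :=
  let N := 2 * l.sum
  (List.range N).flatMap fun t =>
    let R := row (columns 1 l) (2 * t)
    let R' := row (columns 1 l) (2 * t + 1)
    [R ++ mirror N R', R' ++ mirror N R]

/-- The topmost vertices of the columns after `t` rounds, in each of which every column has lost its
topmost vertex and its lowest vertex. -/
def topmost (C : List (List ℕ)) (t : ℕ) : List ℕ :=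
  C.filterMap fun v => if 2 * t + 1 ≤ v.length then v[t]? else none

/-- The lowest vertices of the columns after `t` such rounds, for those columns that have at least
two vertices left. -/
def lowest (C : List (List ℕ)) (t : ℕ) : List ℕ :=
  C.filterMap fun v => if 2 * t + 2 ≤ v.length then v.reverse[t]? else none

/-- The chains through the central column `Z` (when it has at least two vertices left) drawn in
round `t`: topmost vertices on the left, topmost vertex of `Z`, topmost vertices on the right,
and the counterpart through the lowest vertices. -/
def throughCentre (N : ℕ) (C : List (List ℕ)) (Z : List ℕ) (t : ℕ) : List (List ℕ) :=
  [topmost C t ++ Z[t]?.toList ++ mirror N (lowest C t),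
    lowest C t ++ Z.reverse[t]?.toList ++ mirror N (topmost C t)]

/-- The same chains when the central column has no vertices left: topmost to topmost, and lowest
to lowest. If there is no lowest vertex on the left, then no line crosses the centre. -/
def acrossCentre (N : ℕ) (C : List (List ℕ)) (t : ℕ) : List (List ℕ) :=
  [topmost C t ++ mirror N (lowest C t), lowest C t ++ mirror N (topmost C t)]

/-- `L_odd(d)`, symplectic case: the columns are joined in rounds, topmost to topmost on the left of
the centre, and lowest to lowest, together with the counterparts. In a round in which the central column has no vertices left and
some other column has exactly one vertex left, the last topmost and the last lowest vertex `k` of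
the left half are joined to their own mirror images `N + 1 - k`. -/
def oddSp (l : List ℕ) (c : ℕ) : List (List ℕ) :=
  let N := 2 * l.sum + c
  let C := columns 1 l
  let Z := List.range' (l.sum + 1) c
  (List.range N).flatMap fun t =>
    if 2 * t + 2 ≤ c then throughCentre N C Z t
    else if ∃ x ∈ l, x = 2 * t + 1 then
      [topmost C t ++ mirror N (topmost C t), lowest C t ++ mirror N (lowest C t)]
    else acrossCentre N C t

/-- The rounds of the orthogonal case. -/
def oddSoRounds (N : ℕ) (C : List (List ℕ)) (Z : List ℕ) : List (List ℕ) :=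
  (List.range N).flatMap fun t =>
    if 2 * t + 2 ≤ Z.length then throughCentre N C Z t else acrossCentre N C t

/-- The row (counted from `0`) of the vertex of a left column of length `x` on the chain through the
middle vertex of a central column of odd length `c`. If no even length on the left exceeds
`c`, the chain joins the middle vertices of the columns of odd length; otherwise it runs through
the row of the middle vertex of the central column in all columns longer than `c`. -/
def spineRow (l : List ℕ) (c x : ℕ) : Option ℕ :=
  if ∃ y ∈ l, Even y ∧ c < y then (if c < x then some (c / 2) else none)
  else (if Odd x then some (x / 2) else none)

/-- The vertex of the left column `v` on that chain, if any. -/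
def spineVertex (l : List ℕ) (c : ℕ) (v : List ℕ) : Option ℕ :=
  (spineRow l c v.length).bind fun k => v[k]?

/-- The left column `v` without its vertex on that chain. -/
def offSpine (l : List ℕ) (c : ℕ) (v : List ℕ) : List ℕ :=
  match spineRow l c v.length with
  | some k => v.eraseIdx k
  | none => v

/-- `L_odd(d)`, orthogonal case. For odd `c` one chain, symmetric under `k ↦ N + 1 - k`, passes
through the middle vertex of the central column; the vertices off this chain are joined in rounds,
topmost to topmost and lowest to lowest. -/
def oddSo (l : List ℕ) (c : ℕ) : List (List ℕ) :=
  let N := 2 * l.sum + c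
  let C := columns 1 l
  let Z := List.range' (l.sum + 1) c
  if Odd c then
    let S := C.filterMap (spineVertex l c)
    (S ++ Z[c / 2]?.toList ++ mirror N S) ::
      oddSoRounds N (C.map (offSpine l c)) (Z.eraseIdx (c / 2))
  else oddSoRounds N C Z

/-- The chains of the line diagram associated to a dimension vector. -/
def chains : Family → List ℕ → Option ℕ → List (List ℕ)
  | .sp, l, none => evenSp l
  | .so, l, none => evenSo l
  | .sp, l, some c => oddSp l c
  | .so, l, some c => oddSo l c

/-- The lines `i — j` of the line diagram: pairs of successive vertices of a chain. -/
def diagramLines (τ : Family) (l : List ℕ) (c : Option ℕ) : List (ℕ × ℕ) :=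
  (chains τ l c).flatMap fun S => S.zip S.tail

/-- The sign of the line `i — j`: for `sp_N` with `N = 2n` it is `+` iff `i ≤ n`, and for
`so_N` it is `+` iff `i + j ≤ N`. -/
def lineSign (τ : Family) (N i j : ℕ) : ℂ :=
  match τ with
  | .sp => if i ≤ N / 2 then 1 else -1
  | .so => if i + j ≤ N then 1 else -1

/-- The matrix `X(d) = ∑ ± E_{ij}`, summed over the lines `i — j` of the diagram. -/
def lineMatrix (τ : Family) (l : List ℕ) (c : Option ℕ) :
    Matrix (Fin (dimVector l c).sum) (Fin (dimVector l c).sum) ℂ :=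
  Matrix.of fun a b =>
    if (a.val + 1, b.val + 1) ∈ diagramLines τ l c then
      lineSign τ (dimVector l c).sum (a.val + 1) (b.val + 1)
    else 0

end LineDiagram

/-! By rank-nullity the theorem reduces to one inequality. The map `A ↦ ⁅A, X⁆` sends p to n, and
dim p = dim m + dim n. Hence dim g^X ≤ dim m forces the image to be all of n, and then dim g^X = dim
m (`isRichardson_of_finrank_centralizer_le`).

Both sides are estimated with the same tool: for functions on a finite set that are equivariant, up
to signs, under an involution, twice the dimension is the number of points plus the sum of the signs
at the fixed points (`two_mul_finrank_equivariant`). Let ε = 1 for sp and ε = -1 for so. Then 2 dim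
m is the number of pairs (i, j) in a common block plus ε times the size of the central block.

For the centralizer, the lines split the vertices into disjoint chains, which the mirror map
permutes (k ↦ bar k), and up to signs X is a nilpotent matrix with one Jordan block per chain. After
a change of signs, a matrix commuting with X is constant along the diagonals of the block belonging
to a pair of chains, so this block has min(len k, len k') parameters. The Lie algebra condition ties
the pair (k, k') to (bar k', bar k). The fixed points carry alternating signs, whence 2 dim g^X ≤ ∑
min(len k, len k') + ε ∑ (len k mod 2).

A chain meets each block at most once, so pairs in a common block are counted by the intersections
of the sets of blocks visited by k and k', and the comparison can be made pair by pair
(`ChainSystem.IsLineMatrix.finrank_centralizer_le`). It is immediate when one set contains the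
other. The diagrams are built so that this holds for all pairs except possibly a chain and its
mirror image. There simplicity enters: the two then differ in a single column length occurring once
on the left, the intersection falls short by one, and the parity terms make up for it. In sp such a
chain meets the centre and has even length; in so it avoids the centre and has odd length
(`Selection.isRichardson_lineMatrix`). It remains to check these conditions for each diagram. -/

namespace LineDiagram

attribute [local instance 100] LieRing.ofAssociativeRing

open Finset

/-! ## Equivariant functions -/

/-- The functions `f` supported in `P` with `f (ι x) = σ x * f x`. -/
def equivariant {X : Type*} (ι : X → X) (σ : X → ℂ) (P : X → Prop) : Submodule ℂ (X → ℂ) where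
  carrier := {f | (∀ x, f (ι x) = σ x * f x) ∧ ∀ x, ¬ P x → f x = 0}
  zero_mem' := ⟨fun _ => by simp, fun _ _ => rfl⟩
  add_mem' := fun hf hg => ⟨fun x => by simp [hf.1 x, hg.1 x, mul_add], fun x hx => by
    simp [hf.2 x hx, hg.2 x hx]⟩
  smul_mem' := fun c f hf => ⟨fun x => by simp [hf.1 x]; ring, fun x hx => by simp [hf.2 x hx]⟩

/-- Twice the dimension of a space of equivariant functions. -/
theorem two_mul_finrank_equivariant {X : Type*} [Fintype X] [DecidableEq X] (ι : X → X)
    (σ : X → ℂ) (P : X → Prop) [DecidablePred P] (hι : ∀ x, ι (ι x) = x) (hP : ∀ x, P (ι x) ↔ P x)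
    (hσ : ∀ x, P x → σ (ι x) * σ x = 1) :
    2 * (Module.finrank ℂ (equivariant ι σ P) : ℂ) =
      #{x | P x} + ∑ x with P x ∧ ι x = x, σ x := by
  -- Averaging over the involution projects onto the equivariant functions, so its trace is their
  -- dimension. The diagonal entry at a point of `P` is 1/2, or (1 + σ x)/2 if the point is fixed.
  let p : (X → ℂ) →ₗ[ℂ] (X → ℂ) :=
    { toFun := fun f x => if P x then (f x + σ (ι x) * f (ι x)) / 2 else 0
      map_add' := fun f g => by
        ext x; by_cases h : P x <;> simp [h]; ring
      map_smul' := fun c f => by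
        ext x; by_cases h : P x <;> simp [h]; ring }
  have hp : LinearMap.IsProj (equivariant ι σ P) p := by
    refine ⟨fun f => ⟨fun x => ?_, fun x hx => by simp [p, hx]⟩, fun f hf => ?_⟩
    · by_cases h : P x
      · simp only [p, LinearMap.coe_mk, AddHom.coe_mk, hP, h, if_true, hι]
        linear_combination (-(f (ι x)) / 2) * hσ x h
      · simp [p, h, hP]
    · ext x
      by_cases h : P x
      · simp only [p, LinearMap.coe_mk, AddHom.coe_mk, h, if_true, hf.1 x]
        linear_combination (f x / 2) * hσ x h
      · simp [p, h, hf.2 x h]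
  have h1 := hp.trace
  rw [← h1, LinearMap.trace_eq_matrix_trace ℂ (Pi.basisFun ℂ X), Matrix.trace]
  simp only [Matrix.diag, LinearMap.toMatrix_apply, Pi.basisFun_apply, Pi.basisFun_repr]
  rw [card_eq_sum_ones, Finset.sum_filter, Finset.sum_filter, Finset.mul_sum]
  push_cast
  rw [← Finset.sum_add_distrib]
  refine Finset.sum_congr rfl fun x _ => ?_
  by_cases h : P x <;> by_cases h' : ι x = x <;> simp [p, h, h']
  ring

/-! ## The classical Lie algebras in coordinates -/

/-- The entry of the form matrix in row `i` (on the skew diagonal). -/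
def formSign (τ : Family) {N : ℕ} (i : Fin N) : ℂ :=
  match τ with
  | .sp => if i.val < N / 2 then 1 else -1
  | .so => 1

/-- `1` in the symplectic case, `-1` in the orthogonal case. -/
def familySign : Family → ℤ
  | .sp => 1
  | .so => -1

theorem formSign_mul_self (τ : Family) {N : ℕ} (i : Fin N) :
    formSign τ i * formSign τ i = 1 := by
  cases τ
  · unfold formSign; split_ifs <;> simp
  · simp [formSign]

theorem formSign_rev (τ : Family) {N : ℕ} (hN : τ = .sp → Even N) (i : Fin N) :
    formSign τ i.rev = -familySign τ * formSign τ i := by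
  cases τ
  · obtain ⟨m, hm⟩ := hN rfl
    have h1 : i.rev.val < N / 2 ↔ ¬ i.val < N / 2 := by rw [Fin.val_rev]; omega
    simp only [formSign, familySign, h1]
    by_cases h : i.val < N / 2 <;> simp [h]
  · simp [formSign, familySign]

/-- The form is a signed skew permutation matrix, so the defining equation splits into scalar
relations between pairs of entries exchanged by reflection in the skew diagonal. -/
theorem mem_classicalLie_iff (τ : Family) {N : ℕ} (A : Matrix (Fin N) (Fin N) ℂ) :
    A ∈ classicalLie τ N ↔ ∀ i j, A j.rev i.rev = -(formSign τ i * formSign τ j) * A i j := by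
  have hJ : ∀ a b : Fin N, formMatrix τ N a b = if b = a.rev then formSign τ a else 0 := by
    intro a b; cases τ <;> rfl
  have h1 : ∀ a b, (A.transpose * formMatrix τ N) a b = A b.rev a * formSign τ b.rev := by
    intro a b
    simp only [Matrix.mul_apply, Matrix.transpose_apply, hJ]
    rw [Finset.sum_eq_single b.rev]
    · simp
    · intro x _ hx
      rw [if_neg, mul_zero]
      rintro rfl; simp at hx
    · simp
  have h2 : ∀ a b, (formMatrix τ N * A) a b = formSign τ a * A a.rev b := by
    intro a b
    simp only [Matrix.mul_apply, hJ]
    rw [Finset.sum_eq_single a.rev]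
    · simp
    · intro x _ hx; simp [hx]
    · simp
  have h3 : A ∈ classicalLie τ N ↔ A.transpose * formMatrix τ N + formMatrix τ N * A = 0 := by
    rw [classicalLie, mem_skewAdjointMatricesLieSubalgebra, mem_skewAdjointMatricesSubmodule,
      Matrix.IsSkewAdjoint, Matrix.IsAdjointPair, Matrix.mul_neg, eq_neg_iff_add_eq_zero]
  rw [h3, ← Matrix.ext_iff]
  simp only [Matrix.add_apply, h1, h2, Matrix.zero_apply]
  constructor
  · intro h i j
    have := h j i.rev
    rw [Fin.rev_rev] at this
    linear_combination formSign τ j * this - A j.rev i.rev * formSign_mul_self τ j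
  · intro h a b
    have := h b.rev a
    rw [Fin.rev_rev] at this
    rw [this]
    linear_combination -formSign τ b.rev * A b.rev a * formSign_mul_self τ a

/-- The matrices of the Lie algebra supported in `P`. -/
def supported (τ : Family) (N : ℕ) (P : Fin N → Fin N → Prop) :
    Submodule ℂ (Matrix (Fin N) (Fin N) ℂ) where
  carrier := {A | A ∈ classicalLie τ N ∧ ∀ i j, ¬ P i j → A i j = 0}
  zero_mem' := ⟨zero_mem _, fun _ _ _ => rfl⟩
  add_mem' := fun hA hB => ⟨add_mem hA.1 hB.1, fun a b h => by
    simp [hA.2 a b h, hB.2 a b h]⟩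
  smul_mem' := fun c A hA => ⟨(classicalLie τ N).smul_mem c hA.1, fun a b h => by
    simp [hA.2 a b h]⟩

-- The involution is reflection in the skew diagonal. Its fixed points are the skew diagonal
-- entries, and the sign is `familySign τ` at each of them.
open Classical in
theorem two_mul_finrank_supported (τ : Family) {N : ℕ} (hN : τ = .sp → Even N)
    (P : Fin N → Fin N → Prop) (hP : ∀ i j, P j.rev i.rev ↔ P i j) :
    2 * (Module.finrank ℂ (supported τ N P) : ℂ) =
      #{x : Fin N × Fin N | P x.1 x.2} + familySign τ * #{i : Fin N | P i i.rev} := by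
  let e : (Fin N × Fin N → ℂ) ≃ₗ[ℂ] Matrix (Fin N) (Fin N) ℂ := LinearEquiv.curry ℂ ℂ _ _
  let ι : Fin N × Fin N → Fin N × Fin N := fun x => (x.2.rev, x.1.rev)
  let σ : Fin N × Fin N → ℂ := fun x => -(formSign τ x.1 * formSign τ x.2)
  have h1 : supported τ N P = (equivariant ι σ fun x => P x.1 x.2).map (e : _ →ₗ[ℂ] _) := by
    ext A
    rw [Submodule.mem_map]
    constructor
    · rintro ⟨h, h'⟩
      rw [mem_classicalLie_iff] at h
      exact ⟨fun x => A x.1 x.2, ⟨fun x => h _ _, fun x hx => h' _ _ hx⟩, rfl⟩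
    · rintro ⟨f, ⟨h, h'⟩, rfl⟩
      exact ⟨(mem_classicalLie_iff _ _).2 fun i j => h (i, j), fun i j hij => h' (i, j) hij⟩
  rw [h1, LinearEquiv.finrank_map_eq, two_mul_finrank_equivariant]
  · congr 1
    rw [Finset.sum_congr rfl (g := fun _ => (familySign τ : ℂ))]
    · rw [Finset.sum_const, nsmul_eq_mul, mul_comm]
      congr 2
      symm
      refine Finset.card_bij (fun i _ => (i, i.rev)) ?_ ?_ ?_
      · intro i hi
        simpa [ι] using hi
      · intro i _ j _ h
        exact (Prod.ext_iff.1 h).1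
      · rintro ⟨i, j⟩ h
        simp only [ι, mem_filter, mem_univ, true_and, Prod.mk.injEq] at h
        obtain ⟨h, rfl, h2⟩ := h
        exact ⟨j.rev, by simpa using h, by simp⟩
    · rintro ⟨i, j⟩ h
      simp only [ι, mem_filter, mem_univ, true_and, Prod.mk.injEq] at h
      obtain ⟨h, rfl, h2⟩ := h
      simp only [σ]
      rw [formSign_rev τ hN]
      linear_combination familySign τ * formSign_mul_self τ j
  · intro x; simp [ι]
  · intro x; exact hP _ _
  · intro x _
    simp only [σ, ι, formSign_rev τ hN]
    have hf : (familySign τ * familySign τ : ℂ) = 1 := by cases τ <;> simp [familySign]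
    linear_combination (formSign τ x.1 * formSign τ x.1 * (formSign τ x.2 * formSign τ x.2)) *
      hf + formSign τ x.1 * formSign τ x.1 * formSign_mul_self τ x.2 + formSign_mul_self τ x.1

/-! ## Reduction to a bound for the centralizer -/

theorem blockIndex_lt (d : List ℕ) : ∀ {a : ℕ}, a < d.sum → blockIndex d a < d.length := by
  induction d with
  | nil => simp
  | cons x d ih =>
    intro a ha
    simp only [blockIndex, List.length_cons]
    split_ifs with h
    · omega
    · have := @ih (a - x) (by simp at ha; omega)
      omega

theorem blockIndex_append (d e : List ℕ) : ∀ a : ℕ, blockIndex (d ++ e) a =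
    if a < d.sum then blockIndex d a else blockIndex e (a - d.sum) + d.length := by
  induction d with
  | nil => simp
  | cons x d ih =>
    intro a
    simp only [List.cons_append, blockIndex, List.sum_cons, List.length_cons, ih]
    split_ifs <;> first | omega | skip
    rw [Nat.sub_sub]; omega

theorem blockIndex_reverse (d : List ℕ) : ∀ {a : ℕ}, a < d.sum →
    blockIndex d.reverse (d.sum - 1 - a) + blockIndex d a + 1 = d.length := by
  induction d with
  | nil => simp
  | cons x d ih =>
    intro a ha
    rw [List.sum_cons] at ha
    rw [List.reverse_cons, blockIndex_append, List.sum_reverse, List.sum_cons, List.length_reverse]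
    simp only [blockIndex, List.length_cons]
    by_cases h : a < x
    · rw [if_neg (by omega), if_pos (by omega), if_pos h]
      omega
    · rw [if_pos (by omega), if_neg h]
      have := @ih (a - x) (by omega)
      rw [show x + d.sum - 1 - a = d.sum - 1 - (a - x) by omega]
      omega

theorem block_rev {d : List ℕ} (hd : d.reverse = d) (a : Fin d.sum) :
    block d a.rev + block d a + 1 = d.length := by
  have := blockIndex_reverse d a.isLt
  rw [hd] at this
  rw [block, block, Fin.val_rev, show d.sum - (a.val + 1) = d.sum - 1 - a.val by omega]
  exact this

theorem mem_nilradical_iff (τ : Family) (d : List ℕ) (A : Matrix (Fin d.sum) (Fin d.sum) ℂ) :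
    A ∈ nilradical τ d ↔ A ∈ classicalLie τ d.sum ∧ ∀ a b, block d b ≤ block d a → A a b = 0 :=
  Iff.rfl

theorem mem_parabolic_iff (τ : Family) (d : List ℕ) (A : Matrix (Fin d.sum) (Fin d.sum) ℂ) :
    A ∈ parabolic τ d ↔ A ∈ classicalLie τ d.sum ∧ ∀ a b, block d b < block d a → A a b = 0 :=
  Iff.rfl

theorem lie_mem_nilradical {τ : Family} {d : List ℕ} {A X : Matrix (Fin d.sum) (Fin d.sum) ℂ}
    (hA : A ∈ parabolic τ d) (hX : X ∈ nilradical τ d) : ⁅A, X⁆ ∈ nilradical τ d := by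
  refine ⟨(classicalLie τ d.sum).lie_mem hA.1 hX.1, fun a b hab => ?_⟩
  rw [Ring.lie_def, Matrix.sub_apply, Matrix.mul_apply, Matrix.mul_apply,
    Finset.sum_eq_zero, Finset.sum_eq_zero, sub_zero]
  · intro x _
    by_cases h : block d x ≤ block d a
    · rw [hX.2 a x h, zero_mul]
    · rw [((mem_parabolic_iff τ d A).1 hA).2 x b (by omega), mul_zero]
  · intro x _
    by_cases h : block d b ≤ block d x
    · rw [hX.2 x b h, mul_zero]
    · rw [((mem_parabolic_iff τ d A).1 hA).2 a x (by omega), zero_mul]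

theorem leviFactor_eq_supported (τ : Family) (d : List ℕ) :
    leviFactor τ d = supported τ d.sum fun i j => block d i = block d j := rfl

/-- The three spaces are given by ≤, = and < between block numbers. Reflection in the skew diagonal
preserves each relation because `Fin.rev` reverses the order of the blocks, so the three counts can
simply be added. -/
theorem finrank_parabolic {τ : Family} {d : List ℕ} (hN : τ = .sp → Even d.sum)
    (hd : d.reverse = d) :
    Module.finrank ℂ (parabolic τ d).toSubmodule =
      Module.finrank ℂ (leviFactor τ d) + Module.finrank ℂ (nilradical τ d) := by
  classical
  have hp : (parabolic τ d).toSubmodule = supported τ d.sum fun i j => block d i ≤ block d j := by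
    ext A
    simp only [supported, LieSubalgebra.mem_toSubmodule, mem_parabolic_iff, not_le]
    rfl
  have hn : nilradical τ d = supported τ d.sum fun i j => block d i < block d j := by
    ext A
    simp only [supported, mem_nilradical_iff, not_lt]
    rfl
  have hb := block_rev hd
  have h1 := two_mul_finrank_supported τ hN (fun i j => block d i ≤ block d j) fun i j => by
    have := hb i; have := hb j; omega
  have h2 := two_mul_finrank_supported τ hN (fun i j => block d i = block d j) fun i j => by
    have := hb i; have := hb j; omega
  have h3 := two_mul_finrank_supported τ hN (fun i j => block d i < block d j) fun i j => by
    have := hb i; have := hb j; omega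
  have key : ∀ {Y : Type} [Fintype Y] (f g : Y → ℕ)
      [DecidablePred fun x => f x ≤ g x] [DecidablePred fun x => f x = g x]
      [DecidablePred fun x => f x < g x],
      (#{x | f x ≤ g x} : ℂ) = #{x | f x = g x} + #{x | f x < g x} := by
    intro Y _ f g _ _ _
    rw [← Nat.cast_add, ← Finset.card_union_of_disjoint]
    · congr 2
      ext x
      simp only [mem_filter, mem_univ, true_and, mem_union]
      omega
    · rw [Finset.disjoint_filter]
      intro x _ h; omega
  have k1 := @key (Fin d.sum × Fin d.sum) _ (fun x => block d x.1) (fun x => block d x.2)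
    (fun _ => Classical.propDecidable _) (fun _ => Classical.propDecidable _)
    (fun _ => Classical.propDecidable _)
  have k2 := @key (Fin d.sum) _ (fun i => block d i) (fun i => block d i.rev)
    (fun _ => Classical.propDecidable _) (fun _ => Classical.propDecidable _)
    (fun _ => Classical.propDecidable _)
  rw [k1, k2] at h1
  rw [hp, hn, leviFactor_eq_supported, ← @Nat.cast_inj ℂ]
  push_cast
  linear_combination (h1 - h2 - h3) / 2

/-- An element of the nilradical whose centralizer is not larger than the Levi factor is a
Richardson element, and its centralizer has the dimension of the Levi factor. -/
theorem isRichardson_of_finrank_centralizer_le {τ : Family} {d : List ℕ}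
    (hN : τ = .sp → Even d.sum) (hd : d.reverse = d) {X : Matrix (Fin d.sum) (Fin d.sum) ℂ}
    (hX : X ∈ nilradical τ d)
    (h : Module.finrank ℂ (centralizer τ X) ≤ Module.finrank ℂ (leviFactor τ d)) :
    IsRichardson τ d X ∧
      Module.finrank ℂ (centralizer τ X) = Module.finrank ℂ (leviFactor τ d) := by
  let ad : (parabolic τ d).toSubmodule →ₗ[ℂ] nilradical τ d :=
    { toFun := fun A => ⟨⁅A.1, X⁆, lie_mem_nilradical A.2 hX⟩
      map_add' := fun A B => by ext1; exact add_lie _ _ _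
      map_smul' := fun c A => by ext1; exact smul_lie _ _ _ }
  have h1 := ad.finrank_range_add_finrank_ker
  rw [finrank_parabolic hN hd] at h1
  -- The kernel is the centralizer inside p(d), which embeds in the centralizer inside g. This
  -- bounds the rank of `ad` below by dim n.
  have h2 : Module.finrank ℂ (LinearMap.ker ad) ≤ Module.finrank ℂ (centralizer τ X) := by
    let f : LinearMap.ker ad →ₗ[ℂ] centralizer τ X :=
      { toFun := fun A => ⟨A.1.1, A.1.2.1, congrArg Subtype.val (LinearMap.mem_ker.1 A.2)⟩
        map_add' := fun A B => rfl
        map_smul' := fun c A => rfl }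
    refine LinearMap.finrank_le_finrank_of_injective (f := f) fun A B hAB => ?_
    exact Subtype.ext (Subtype.ext (congrArg (fun C : centralizer τ X => C.1) hAB))
  have h3 := Submodule.finrank_le (LinearMap.range ad)
  refine ⟨⟨hX, ?_⟩, by omega⟩
  have h4 : LinearMap.range ad = ⊤ := Submodule.eq_top_of_finrank_eq (by omega)
  ext Y
  constructor
  · rintro ⟨A, hA, rfl⟩
    exact lie_mem_nilradical hA hX
  · intro hY
    obtain ⟨A, hA⟩ := LinearMap.range_eq_top.1 h4 ⟨Y, hY⟩
    exact ⟨A.1, A.2, congrArg Subtype.val hA⟩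

/-! ## Centralizers of matrices supported on symmetric systems of chains -/

/-- A partition of `Fin N` into chains, stable under `Fin.rev`: the vertex `vert k a` is the one at
position `a < len k` of the chain `k`, and `Fin.rev` maps the chain `k` to the chain `bar k`,
reversing the order. -/
structure ChainSystem (N : ℕ) (K : Type*) where
  len : K → ℕ
  vert : K → ℕ → Fin N
  bar : K → K
  chain : Fin N → K
  pos : Fin N → ℕ
  pos_lt : ∀ v, pos v < len (chain v)
  vert_chain_pos : ∀ v, vert (chain v) (pos v) = v
  chain_vert : ∀ k a, a < len k → chain (vert k a) = k
  pos_vert : ∀ k a, a < len k → pos (vert k a) = a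
  bar_bar : ∀ k, bar (bar k) = k
  len_bar : ∀ k, len (bar k) = len k
  rev_vert : ∀ k a, a < len k → (vert k a).rev = vert (bar k) (len k - 1 - a)

theorem sum_fin_ite_lt {R : Type*} [AddCommMonoid R] (f : ℕ → R) {n M : ℕ} (h : n ≤ M) :
    ∑ m : Fin M, (if m.val < n then f m else 0) = ∑ m ∈ range n, f m := by
  rw [Fin.sum_univ_eq_sum_range (fun m => if m < n then f m else 0) M, ← Finset.sum_filter]
  congr 1
  ext m
  simp only [mem_filter, mem_range]
  omega

namespace ChainSystem

variable {N : ℕ} {K : Type*} (S : ChainSystem N K)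

/-- `X` is supported on the pairs of successive vertices of chains, with entries `±1` there. -/
structure IsLineMatrix (X : Matrix (Fin N) (Fin N) ℂ) : Prop where
  line_of_ne_zero : ∀ i j, X i j ≠ 0 → S.chain i = S.chain j ∧ S.pos j = S.pos i + 1
  mul_self : ∀ i j, S.chain i = S.chain j → S.pos j = S.pos i + 1 → X i j * X i j = 1

/-- The entry of `X` at the line from position `a` to position `a + 1` of the chain `k`. -/
def lineEntry (X : Matrix (Fin N) (Fin N) ℂ) (k : K) (a : ℕ) : ℂ :=
  X (S.vert k a) (S.vert k (a + 1))

/-- The product of the entries of `X` at the first `a` lines of the chain `k`. -/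
def gauge (X : Matrix (Fin N) (Fin N) ℂ) (k : K) (a : ℕ) : ℂ :=
  ∏ t ∈ range a, S.lineEntry X k t

/-- The entries of `A`, renormalized so that they are constant along diagonals if `A` commutes
with `X`. -/
def gaugedEntry (X A : Matrix (Fin N) (Fin N) ℂ) (k k' : K) (a b : ℕ) : ℂ :=
  S.gauge X k a * S.gauge X k' b * A (S.vert k a) (S.vert k' b)

/-- The sign by which the renormalized entries of an element of the Lie algebra change under the
symmetry. -/
def gaugeSign (τ : Family) (X : Matrix (Fin N) (Fin N) ℂ) (k : K) (a : ℕ) : ℂ :=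
  formSign τ (S.vert k a) * S.gauge X k a * S.gauge X (S.bar k) (S.len k - 1 - a)

variable {S} {X A : Matrix (Fin N) (Fin N) ℂ}

theorem gauge_succ (X : Matrix (Fin N) (Fin N) ℂ) (k : K) (a : ℕ) :
    S.gauge X k (a + 1) = S.gauge X k a * S.lineEntry X k a := prod_range_succ _ _

theorem IsLineMatrix.lineEntry_mul_self (hX : S.IsLineMatrix X) {k : K} {a : ℕ}
    (ha : a + 1 < S.len k) : S.lineEntry X k a * S.lineEntry X k a = 1 :=
  hX.mul_self _ _ (by rw [S.chain_vert _ _ ha, S.chain_vert _ _ (by omega)])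
    (by rw [S.pos_vert _ _ ha, S.pos_vert _ _ (by omega)])

theorem IsLineMatrix.gauge_mul_self (hX : S.IsLineMatrix X) {k : K} {a : ℕ}
    (ha : a < S.len k) : S.gauge X k a * S.gauge X k a = 1 := by
  rw [gauge, ← prod_mul_distrib]
  exact prod_eq_one fun t ht => hX.lineEntry_mul_self (by rw [mem_range] at ht; omega)

theorem IsLineMatrix.eq_vert_of_ne_zero_left (hX : S.IsLineMatrix X) {k : K} {b : ℕ}
    (hb : b < S.len k) {x : Fin N} (h : X x (S.vert k b) ≠ 0) :
    0 < b ∧ x = S.vert k (b - 1) := by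
  obtain ⟨h1, h2⟩ := hX.line_of_ne_zero _ _ h
  rw [S.chain_vert _ _ hb] at h1
  rw [S.pos_vert _ _ hb] at h2
  refine ⟨by omega, ?_⟩
  rw [← S.vert_chain_pos x, h1, h2, Nat.add_sub_cancel]

theorem IsLineMatrix.eq_vert_of_ne_zero_right (hX : S.IsLineMatrix X) {k : K} {a : ℕ}
    (ha : a < S.len k) {x : Fin N} (h : X (S.vert k a) x ≠ 0) :
    a + 1 < S.len k ∧ x = S.vert k (a + 1) := by
  obtain ⟨h1, h2⟩ := hX.line_of_ne_zero _ _ h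
  rw [S.chain_vert _ _ ha] at h1
  rw [S.pos_vert _ _ ha] at h2
  have := S.pos_lt x
  rw [← h1, h2] at this
  refine ⟨this, ?_⟩
  rw [← S.vert_chain_pos x, ← h1, h2]

theorem IsLineMatrix.mul_apply_vert_succ (hX : S.IsLineMatrix X) (i : Fin N) {k : K} {b : ℕ}
    (hb : b + 1 < S.len k) :
    (A * X) i (S.vert k (b + 1)) = A i (S.vert k b) * S.lineEntry X k b := by
  rw [Matrix.mul_apply, Finset.sum_eq_single (S.vert k b)]
  · rfl
  · intro x _ hx
    by_contra h
    exact hx (hX.eq_vert_of_ne_zero_left hb (right_ne_zero_of_mul h)).2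
  · simp

theorem IsLineMatrix.mul_apply_vert_zero (hX : S.IsLineMatrix X) (i : Fin N) {k : K}
    (hk : 0 < S.len k) : (A * X) i (S.vert k 0) = 0 := by
  rw [Matrix.mul_apply]
  refine Finset.sum_eq_zero fun x _ => ?_
  by_contra h
  exact absurd (hX.eq_vert_of_ne_zero_left hk (right_ne_zero_of_mul h)).1 (lt_irrefl 0)

theorem IsLineMatrix.apply_vert_mul (hX : S.IsLineMatrix X) (j : Fin N) {k : K} {a : ℕ}
    (ha : a + 1 < S.len k) :
    (X * A) (S.vert k a) j = S.lineEntry X k a * A (S.vert k (a + 1)) j := by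
  rw [Matrix.mul_apply, Finset.sum_eq_single (S.vert k (a + 1))]
  · rfl
  · intro x _ hx
    by_contra h
    exact hx (hX.eq_vert_of_ne_zero_right (by omega) (left_ne_zero_of_mul h)).2
  · simp

theorem IsLineMatrix.apply_vert_last_mul (hX : S.IsLineMatrix X) (j : Fin N) {k : K}
    (hk : 0 < S.len k) : (X * A) (S.vert k (S.len k - 1)) j = 0 := by
  rw [Matrix.mul_apply]
  refine Finset.sum_eq_zero fun x _ => ?_
  by_contra h
  have := (hX.eq_vert_of_ne_zero_right (by omega) (left_ne_zero_of_mul h)).1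
  omega

/-- At the entry in row `vert k a` and column `vert k' (b + 1)` each side of AX = XA has a single
term; the gauges absorb the signs of the two lines involved. -/
theorem IsLineMatrix.gaugedEntry_succ (hX : S.IsLineMatrix X) (hA : A * X = X * A) {k k' : K}
    {a b : ℕ} (ha : a + 1 < S.len k) (hb : b + 1 < S.len k') :
    S.gaugedEntry X A k k' (a + 1) (b + 1) = S.gaugedEntry X A k k' a b := by
  have h1 : A (S.vert k a) (S.vert k' b) * S.lineEntry X k' b =
      S.lineEntry X k a * A (S.vert k (a + 1)) (S.vert k' (b + 1)) := by
    rw [← hX.mul_apply_vert_succ _ hb, ← hX.apply_vert_mul _ ha, hA]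
  have h2 := hX.lineEntry_mul_self hb
  rw [gaugedEntry, gauge_succ, gauge_succ, gaugedEntry]
  linear_combination S.gauge X k a * S.gauge X k' b *
    (A (S.vert k a) (S.vert k' b) * h2 - S.lineEntry X k' b * h1)

theorem IsLineMatrix.gaugedEntry_add (hX : S.IsLineMatrix X) (hA : A * X = X * A) {k k' : K}
    {a b : ℕ} : ∀ m, a + m < S.len k → b + m < S.len k' →
    S.gaugedEntry X A k k' (a + m) (b + m) = S.gaugedEntry X A k k' a b
  | 0, _, _ => rfl
  | m + 1, ha, hb => by
    rw [← hX.gaugedEntry_add hA (a := a) (b := b) m (by omega) (by omega)]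
    exact hX.gaugedEntry_succ hA (a := a + m) (b := b + m) ha hb

/-- Slide back along the diagonal to the first vertex of `k'`. No line ends there, so AX vanishes in
that column, while XA isolates the entry. -/
theorem IsLineMatrix.gaugedEntry_eq_zero_of_lt (hX : S.IsLineMatrix X) (hA : A * X = X * A)
    {k k' : K} {a b : ℕ} (ha : a < S.len k) (hb : b < S.len k') (hab : b < a) :
    S.gaugedEntry X A k k' a b = 0 := by
  obtain ⟨c, rfl⟩ : ∃ c, a = c + 1 + b := ⟨a - b - 1, by omega⟩
  have h := hX.gaugedEntry_add hA (k := k) (k' := k') (a := c + 1) (b := 0) b ha (by omega)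
  rw [zero_add] at h
  rw [h, gaugedEntry]
  have h1 := hX.apply_vert_mul (A := A) (S.vert k' 0) (k := k) (a := c) (by omega)
  rw [← hA, hX.mul_apply_vert_zero _ (by omega)] at h1
  have h2 := hX.lineEntry_mul_self (k := k) (a := c) (by omega)
  linear_combination -(S.gauge X k (c + 1) * S.gauge X k' 0) * (S.lineEntry X k c * h1 +
    A (S.vert k (c + 1)) (S.vert k' 0) * h2)

/-- Dually, slide forward to the last vertex of `k`, where no line starts and XA vanishes. -/
theorem IsLineMatrix.gaugedEntry_eq_zero_of_gt (hX : S.IsLineMatrix X) (hA : A * X = X * A)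
    {k k' : K} {a b : ℕ} (ha : a < S.len k)
    (hab : S.len k + b < S.len k' + a) : S.gaugedEntry X A k k' a b = 0 := by
  obtain ⟨m, hm⟩ : ∃ m, S.len k = a + m + 1 := ⟨S.len k - a - 1, by omega⟩
  rw [← hX.gaugedEntry_add hA m (by omega) (by omega), gaugedEntry]
  have h1 := hX.mul_apply_vert_succ (A := A) (S.vert k (a + m)) (k := k') (b := b + m) (by omega)
  rw [hA, show a + m = S.len k - 1 by omega, hX.apply_vert_last_mul _ (by omega)] at h1
  have h2 := hX.lineEntry_mul_self (k := k') (a := b + m) (by omega)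
  rw [show a + m = S.len k - 1 by omega]
  linear_combination -(S.gauge X k (S.len k - 1) * S.gauge X k' (b + m)) *
    (S.lineEntry X k' (b + m) * h1 + A (S.vert k (S.len k - 1)) (S.vert k' (b + m)) * h2)

theorem IsLineMatrix.gaugeSign_mul_self (hX : S.IsLineMatrix X) (τ : Family) {k : K} {a : ℕ}
    (ha : a < S.len k) : S.gaugeSign τ X k a * S.gaugeSign τ X k a = 1 := by
  have h1 := formSign_mul_self τ (S.vert k a)
  have h2 := hX.gauge_mul_self ha
  have h3 := hX.gauge_mul_self (k := S.bar k) (a := S.len k - 1 - a) (by rw [S.len_bar]; omega)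
  calc _ = (formSign τ (S.vert k a) * formSign τ (S.vert k a)) *
      (S.gauge X k a * S.gauge X k a) *
      (S.gauge X (S.bar k) (S.len k - 1 - a) * S.gauge X (S.bar k) (S.len k - 1 - a)) := by
        rw [gaugeSign]; ring
    _ = 1 := by rw [h1, h2, h3]; norm_num

/-- One step along `k` adds a line to the gauge of `k` and removes its mirror image from the gauge
of `bar k`. As X lies in the Lie algebra, these two entries differ by minus the product of two form
signs, which leaves a factor -1. -/
theorem gaugeSign_succ {τ : Family} (hXc : X ∈ classicalLie τ N)
    {k : K} {a : ℕ} (ha : a + 1 < S.len k) :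
    S.gaugeSign τ X k (a + 1) = -S.gaugeSign τ X k a := by
  obtain ⟨b, hb⟩ : ∃ b, S.len k = a + b + 2 := ⟨S.len k - a - 2, by omega⟩
  have h1 : S.lineEntry X (S.bar k) b =
      -(formSign τ (S.vert k a) * formSign τ (S.vert k (a + 1))) * S.lineEntry X k a := by
    rw [lineEntry, lineEntry, ← (mem_classicalLie_iff τ X).1 hXc, S.rev_vert k a (by omega),
      S.rev_vert k (a + 1) (by omega)]
    congr 2 <;> omega
  rw [gaugeSign, gaugeSign, gauge_succ, show S.len k - 1 - (a + 1) = b by omega,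
    show S.len k - 1 - a = b + 1 by omega, gauge_succ, h1]
  linear_combination -(formSign τ (S.vert k (a + 1)) * S.gauge X k a * S.lineEntry X k a *
    S.gauge X (S.bar k) b) * formSign_mul_self τ (S.vert k a)

theorem gaugeSign_eq {τ : Family} (hXc : X ∈ classicalLie τ N) {k : K} :
    ∀ {a : ℕ}, a < S.len k → S.gaugeSign τ X k a = (-1) ^ a * S.gaugeSign τ X k 0
  | 0, _ => by simp
  | a + 1, ha => by
    rw [gaugeSign_succ hXc ha, gaugeSign_eq hXc (by omega), pow_succ]
    ring

theorem gaugeSign_bar {τ : Family} (hN : τ = .sp → Even N) {k : K} {a : ℕ} (ha : a < S.len k) :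
    S.gaugeSign τ X (S.bar k) (S.len k - 1 - a) = -familySign τ * S.gaugeSign τ X k a := by
  rw [gaugeSign, gaugeSign, ← S.rev_vert k a ha, formSign_rev τ hN, S.len_bar, S.bar_bar,
    show S.len k - 1 - (S.len k - 1 - a) = a by omega]
  ring

/-- The reflection moves the entry to position (m, len k - 1) of the pair (bar k', bar k), and m
steps back along the diagonal lead to its first row. Thus the number m of a diagonal, counted from
the end of the second chain, is preserved by the symmetry. -/
theorem IsLineMatrix.gaugedEntry_bar (hX : S.IsLineMatrix X) (hA : A * X = X * A) {τ : Family}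
    (hAc : A ∈ classicalLie τ N) {k k' : K} {m : ℕ} (hm : m < S.len k) (hm' : m < S.len k') :
    S.gaugedEntry X A (S.bar k') (S.bar k) 0 (S.len k - 1 - m) =
      -(S.gaugeSign τ X k 0 * S.gaugeSign τ X k' (S.len k' - 1 - m)) *
        S.gaugedEntry X A k k' 0 (S.len k' - 1 - m) := by
  rw [← hX.gaugedEntry_add hA m (by rw [S.len_bar]; omega) (by rw [S.len_bar]; omega), zero_add,
    show S.len k - 1 - m + m = S.len k - 1 by omega]
  have h1 : S.vert (S.bar k') m = (S.vert k' (S.len k' - 1 - m)).rev := by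
    rw [S.rev_vert _ _ (by omega)]; congr 1; omega
  have h2 : S.vert (S.bar k) (S.len k - 1) = (S.vert k 0).rev := by
    rw [S.rev_vert _ _ (by omega)]; congr 1
  rw [gaugedEntry, gaugedEntry, h1, h2, (mem_classicalLie_iff τ A).1 hAc, gaugeSign, gaugeSign,
    show S.len k' - 1 - (S.len k' - 1 - m) = m by omega, Nat.sub_zero]
  have h3 := hX.gauge_mul_self (k := k) (a := 0) (by omega)
  have h4 := hX.gauge_mul_self (k := k') (a := S.len k' - 1 - m) (by omega)
  set e := formSign τ (S.vert k 0)
  set e' := formSign τ (S.vert k' (S.len k' - 1 - m))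
  set g := S.gauge X k 0
  set g' := S.gauge X k' (S.len k' - 1 - m)
  set α := A (S.vert k 0) (S.vert k' (S.len k' - 1 - m))
  linear_combination e * e' * S.gauge X (S.bar k') m * S.gauge X (S.bar k) (S.len k - 1) * α *
    (g' * g' * h3 + h4)

open Classical in
/-- The bound for the dimension of the centralizer in terms of the lengths of the chains. -/
theorem IsLineMatrix.two_mul_finrank_centralizer_le [Fintype K] (hX : S.IsLineMatrix X)
    {τ : Family} (hN : τ = .sp → Even N) (hXc : X ∈ classicalLie τ N) :
    2 * (Module.finrank ℂ (centralizer τ X) : ℤ) ≤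
      (∑ k, ∑ k', min (S.len k) (S.len k') : ℕ) + familySign τ * (∑ k, S.len k % 2 : ℕ) := by
  let M := ∑ k, S.len k
  have hM : ∀ k, S.len k ≤ M := fun k => single_le_sum (f := S.len) (fun _ _ => Nat.zero_le _)
    (mem_univ k)
  let ι : K × K × Fin M → K × K × Fin M := fun x => (S.bar x.2.1, S.bar x.1, x.2.2)
  let P : K × K × Fin M → Prop := fun x => x.2.2 < S.len x.1 ∧ x.2.2 < S.len x.2.1
  let σ : K × K × Fin M → ℂ := fun x =>
    -(S.gaugeSign τ X x.1 0 * S.gaugeSign τ X x.2.1 (S.len x.2.1 - 1 - x.2.2))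
  -- Reconstructs a matrix from its values on diagonals: the diagonal through position (a, b) has
  -- number a + (len k' - 1 - b). The total length `M` only serves as a common bound for these
  -- numbers.
  let Φ : (K × K × Fin M → ℂ) →ₗ[ℂ] Matrix (Fin N) (Fin N) ℂ :=
    { toFun := fun F => Matrix.of fun i j =>
        if h : S.pos i + (S.len (S.chain j) - 1 - S.pos j) < M then
          S.gauge X (S.chain i) (S.pos i) * S.gauge X (S.chain j) (S.pos j) *
            F (S.chain i, S.chain j, ⟨_, h⟩)
        else 0
      map_add' := fun F G => by
        ext i j
        simp only [Matrix.of_apply, Matrix.add_apply, Pi.add_apply]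
        split_ifs <;> ring
      map_smul' := fun c F => by
        ext i j
        simp only [Matrix.of_apply, Matrix.smul_apply, Pi.smul_apply, smul_eq_mul, RingHom.id_apply]
        split_ifs <;> ring }
  have hle : centralizer τ X ≤ (equivariant ι σ P).map Φ := by
    rintro A ⟨hAc, hA⟩
    have hA : A * X = X * A := sub_eq_zero.1 hA
    refine ⟨fun x => if P x then S.gaugedEntry X A x.1 x.2.1 0 (S.len x.2.1 - 1 - x.2.2) else 0,
      ⟨?_, fun x hx => if_neg hx⟩, ?_⟩
    · rintro ⟨k, k', m⟩
      by_cases h : P (k, k', m)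
      · beta_reduce
        rw [if_pos (by simpa [P, ι, S.len_bar] using h.symm), if_pos h]
        simp only [ι, σ, S.len_bar]
        exact hX.gaugedEntry_bar hA hAc h.1 h.2
      · beta_reduce
        rw [if_neg (by simpa [P, ι, S.len_bar, and_comm] using h), if_neg h, mul_zero]
    · ext i j
      have hi := S.pos_lt i
      have hj := S.pos_lt j
      have key : A i j = S.gauge X (S.chain i) (S.pos i) * S.gauge X (S.chain j) (S.pos j) *
          S.gaugedEntry X A (S.chain i) (S.chain j) (S.pos i) (S.pos j) := by
        rw [gaugedEntry, S.vert_chain_pos, S.vert_chain_pos]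
        have h1 := hX.gauge_mul_self hi
        have h2 := hX.gauge_mul_self hj
        linear_combination -(A i j) * (h1 * (S.gauge X (S.chain j) (S.pos j)) ^ 2 + h2)
      rw [key]
      simp only [Φ, LinearMap.coe_mk, AddHom.coe_mk, Matrix.of_apply, P]
      -- A diagonal contributes only if its number is below both lengths; each failure is one of the
      -- two vanishing lemmas.
      by_cases h1 : S.pos i + (S.len (S.chain j) - 1 - S.pos j) < S.len (S.chain i)
      · rw [dif_pos (h1.trans_le (hM _))]
        by_cases h2 : S.pos i ≤ S.pos j
        · rw [if_pos ⟨h1, by omega⟩, ← hX.gaugedEntry_add hA (a := 0) (S.pos i) (by omega)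
            (by omega), zero_add]
          congr 2
          omega
        · rw [if_neg (by omega), hX.gaugedEntry_eq_zero_of_lt hA hi hj (by omega)]
      · rw [hX.gaugedEntry_eq_zero_of_gt hA hi (by omega)]
        split_ifs <;> first | omega | simp
  have h1 : Module.finrank ℂ (centralizer τ X) ≤ Module.finrank ℂ (equivariant ι σ P) :=
    (Submodule.finrank_mono hle).trans (Submodule.finrank_map_le _ _)
  have h2 := two_mul_finrank_equivariant ι σ P (fun x => by simp [ι, S.bar_bar])
    (fun x => by simp [P, ι, S.len_bar, and_comm]) (fun x hx => by
      obtain ⟨k, k', ⟨m, hm⟩⟩ := x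
      obtain ⟨h1, h2⟩ : m < S.len k ∧ m < S.len k' := hx
      simp only [σ, ι, S.len_bar]
      obtain ⟨q, hq⟩ : ∃ q, S.len k' = q + m + 1 := ⟨S.len k' - m - 1, by omega⟩
      have e1 := gaugeSign_bar (S := S) (X := X) hN (k := k') (a := S.len k' - 1) (by omega)
      rw [Nat.sub_self, gaugeSign_eq hXc (by omega : S.len k' - 1 < S.len k')] at e1
      rw [gaugeSign_bar hN h1, gaugeSign_eq hXc h1, e1,
        gaugeSign_eq hXc (by omega : S.len k' - 1 - m < S.len k'),
        show S.len k' - 1 - m = q by omega, show S.len k' - 1 = q + m by omega]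
      have e2 := hX.gaugeSign_mul_self τ (k := k) (a := 0) (by omega)
      have e3 := hX.gaugeSign_mul_self τ (k := k') (a := 0) (by omega)
      have e4 : (familySign τ * familySign τ : ℂ) = 1 := by cases τ <;> simp [familySign]
      have e5 : ((-1) ^ (q + m) * ((-1) ^ m * (-1) ^ q) : ℂ) = 1 := by
        rw [← pow_add, ← pow_add, show q + m + (m + q) = 2 * (q + m) by ring, pow_mul]
        simp
      calc _ = ((familySign τ * familySign τ : ℂ)) * ((-1) ^ (q + m) * ((-1) ^ m * (-1) ^ q)) *
          (S.gaugeSign τ X k 0 * S.gaugeSign τ X k 0) *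
          (S.gaugeSign τ X k' 0 * S.gaugeSign τ X k' 0) := by ring
        _ = 1 := by rw [e2, e3, e4, e5]; norm_num)
  have h3 : #{x | P x} = ∑ k, ∑ k', min (S.len k) (S.len k') := by
    rw [card_filter, Fintype.sum_prod_type]
    refine Finset.sum_congr rfl fun k _ => ?_
    rw [Fintype.sum_prod_type]
    refine Finset.sum_congr rfl fun k' _ => ?_
    simp only [P, ← lt_min_iff]
    rw [sum_fin_ite_lt (fun _ => 1) ((min_le_left _ _).trans (hM k))]
    simp
  -- The fixed triples are (k, bar k, m), with sign `familySign τ * (-1) ^ m`; the alternating sum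
  -- over m < len k is 1 or 0 according to the parity of len k.
  have h4 : ∑ x with P x ∧ ι x = x, σ x = familySign τ * ∑ k, ((S.len k % 2 : ℕ) : ℂ) := by
    rw [Finset.sum_filter, Fintype.sum_prod_type, Finset.mul_sum]
    refine Finset.sum_congr rfl fun k _ => ?_
    rw [Fintype.sum_prod_type, Finset.sum_eq_single (S.bar k)]
    · rw [Finset.sum_congr rfl (g := fun m : Fin M =>
        if m.val < S.len k then familySign τ * (-1 : ℂ) ^ m.val else 0)]
      · rw [sum_fin_ite_lt (fun m => familySign τ * (-1 : ℂ) ^ m) (hM k), ← Finset.mul_sum,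
          neg_one_geom_sum]
        rcases Nat.mod_two_eq_zero_or_one (S.len k) with h | h
        · rw [if_pos (Nat.even_iff.2 h), h]; simp
        · rw [if_neg (by rw [Nat.even_iff]; omega), h]; simp
      · intro m _
        simp only [P, ι, σ, S.len_bar, S.bar_bar, and_self, and_true]
        split_ifs with h
        · rw [gaugeSign_bar hN h, gaugeSign_eq hXc h]
          have := hX.gaugeSign_mul_self τ (k := k) (a := 0) (by omega)
          linear_combination (familySign τ * (-1 : ℂ) ^ m.val) * this
        · rfl
    · intro k' _ hk'
      refine Finset.sum_eq_zero fun m _ => if_neg ?_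
      rintro ⟨-, h⟩
      exact hk' (Prod.ext_iff.1 (Prod.ext_iff.1 h).2).1.symm
    · simp
  rw [h3, h4] at h2
  have h5 : 2 * (Module.finrank ℂ (equivariant ι σ P) : ℤ) =
      (∑ k, ∑ k', min (S.len k) (S.len k') : ℕ) + familySign τ * (∑ k, S.len k % 2 : ℕ) := by
    rw [← @Int.cast_inj ℂ]
    simp only [Int.cast_mul, Int.cast_add, Int.cast_natCast, Int.cast_ofNat, Int.cast_sum, Nat.cast_sum] at h2 ⊢
    exact h2
  omega

end ChainSystem

/-! ### Comparing centralizer and Levi factor through the blocks visited by chains. -/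

namespace ChainSystem

/-- The blocks visited by the chain `k`. -/
def blocks {d : List ℕ} {K : Type*} (S : ChainSystem d.sum K) (k : K) : Finset ℕ :=
  (range (S.len k)).image fun a => block d (S.vert k a)

open Classical in
/-- The number of vertices of the chain `k` in the central block. -/
noncomputable def centralCard {d : List ℕ} {K : Type*} (S : ChainSystem d.sum K) (k : K) : ℕ :=
  #{i | S.chain i = k ∧ block d i = block d i.rev}

section

variable {d : List ℕ} {K : Type*} {S : ChainSystem d.sum K}
  {X : Matrix (Fin d.sum) (Fin d.sum) ℂ} {τ : Family}

theorem mem_blocks {k : K} {b : ℕ} :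
    b ∈ S.blocks k ↔ ∃ i, S.chain i = k ∧ block d i = b := by
  simp only [blocks, mem_image, mem_range]
  constructor
  · rintro ⟨a, ha, rfl⟩
    exact ⟨_, S.chain_vert k a ha, rfl⟩
  · rintro ⟨i, rfl, rfl⟩
    exact ⟨S.pos i, S.pos_lt i, by rw [S.vert_chain_pos]⟩

/-- Entries at lines square to 1, and entries of an element of n vanish unless the block number
increases. -/
theorem IsLineMatrix.block_lt_of_lt (hX : S.IsLineMatrix X) (hn : X ∈ nilradical τ d) {k : K}
    {a : ℕ} : ∀ {b : ℕ}, a < b → b < S.len k →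
    block d (S.vert k a) < block d (S.vert k b)
  | 0, h, _ => by omega
  | b + 1, h, hb => by
    have h1 : block d (S.vert k b) < block d (S.vert k (b + 1)) := by
      by_contra hle
      have h0 := hX.lineEntry_mul_self hb
      rw [lineEntry, hn.2 _ _ (not_lt.1 hle), zero_mul] at h0
      exact zero_ne_one h0
    rcases Nat.lt_succ_iff_lt_or_eq.1 h with h2 | rfl
    · exact (hX.block_lt_of_lt hn h2 (by omega)).trans h1
    · exact h1

theorem IsLineMatrix.card_blocks (hX : S.IsLineMatrix X) (hn : X ∈ nilradical τ d) (k : K) :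
    #(S.blocks k) = S.len k := by
  rw [blocks, card_image_of_injOn, card_range]
  intro a ha b hb hab
  rw [coe_range, Set.mem_Iio] at ha hb
  beta_reduce at hab
  rcases lt_trichotomy a b with h | h | h
  · have := hX.block_lt_of_lt hn h hb; omega
  · exact h
  · have := hX.block_lt_of_lt hn h ha; omega

-- For fixed `k`, the parity terms are charged to the pair (k, bar k); summing the resulting
-- inequalities compares the two dimension counts.
open Classical in
theorem IsLineMatrix.finrank_centralizer_le [Fintype K] (hX : S.IsLineMatrix X)
    (hN : τ = .sp → Even d.sum) (hd : d.reverse = d) (hn : X ∈ nilradical τ d)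
    (h1 : ∀ k k', k' ≠ S.bar k → min (S.len k) (S.len k') ≤ #(S.blocks k ∩ S.blocks k'))
    (h2 : ∀ k, (S.len k + familySign τ * (S.len k % 2 : ℕ) : ℤ) ≤
      #(S.blocks k ∩ S.blocks (S.bar k)) + familySign τ * S.centralCard k) :
    Module.finrank ℂ (centralizer τ X) ≤ Module.finrank ℂ (leviFactor τ d) := by
  have hb := block_rev hd
  have e1 := hX.two_mul_finrank_centralizer_le hN hn.1
  have e2 := two_mul_finrank_supported τ hN (fun i j => block d i = block d j) fun i j => by
    have := hb i; have := hb j; omega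
  rw [← leviFactor_eq_supported] at e2
  replace e2 : 2 * (Module.finrank ℂ (leviFactor τ d) : ℤ) =
      #{x : Fin d.sum × Fin d.sum | block d x.1 = block d x.2} +
        familySign τ * #{i : Fin d.sum | block d i = block d i.rev} := by
    rw [← @Int.cast_inj ℂ]
    simp only [Int.cast_mul, Int.cast_add, Int.cast_natCast, Int.cast_ofNat]
    convert e2 <;> rfl
  have e3 : #{i : Fin d.sum | block d i = block d i.rev} = ∑ k, S.centralCard k := by
    rw [card_eq_sum_card_fiberwise (f := S.chain) (t := univ) fun _ _ => mem_coe.2 (mem_univ _)]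
    refine Finset.sum_congr rfl fun k _ => ?_
    rw [centralCard, Finset.filter_filter]
    simp only [and_comm]
  -- A block visited by both chains yields a pair of vertices, one on each chain; this inequality
  -- suffices.
  have e4 : ∑ k, ∑ k', #(S.blocks k ∩ S.blocks k') ≤
      #{x : Fin d.sum × Fin d.sum | block d x.1 = block d x.2} := by
    rw [card_eq_sum_card_fiberwise (f := fun x => (S.chain x.1, S.chain x.2)) (t := univ)
      fun _ _ => mem_coe.2 (mem_univ _), Fintype.sum_prod_type]
    refine Finset.sum_le_sum fun k _ => Finset.sum_le_sum fun k' _ => ?_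
    refine (card_le_card ?_).trans (card_image_le (f := fun x => block d x.1))
    intro b hb
    rw [mem_inter, mem_blocks, mem_blocks] at hb
    obtain ⟨⟨i, rfl, rfl⟩, j, rfl, hj⟩ := hb
    exact mem_image.2 ⟨(i, j), by simp [hj], rfl⟩
  have e5 : ∀ k, (∑ k', (min (S.len k) (S.len k') : ℤ)) + familySign τ * (S.len k % 2 : ℕ) ≤
      (∑ k', (#(S.blocks k ∩ S.blocks k') : ℤ)) + familySign τ * S.centralCard k := by
    intro k
    rw [← Finset.add_sum_erase _ _ (mem_univ (S.bar k)),
      ← Finset.add_sum_erase _ (fun k' => (#(S.blocks k ∩ S.blocks k') : ℤ)) (mem_univ (S.bar k))]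
    have := h2 k
    rw [S.len_bar, min_self]
    have h3 : ∑ k' ∈ univ.erase (S.bar k), (min (S.len k) (S.len k') : ℤ) ≤
        ∑ k' ∈ univ.erase (S.bar k), (#(S.blocks k ∩ S.blocks k') : ℤ) :=
      Finset.sum_le_sum fun k' hk' => by exact_mod_cast h1 k k' (ne_of_mem_erase hk')
    linarith
  have e6 := Finset.sum_le_sum fun k (_ : k ∈ univ) => e5 k
  rw [Finset.sum_add_distrib, Finset.sum_add_distrib, ← Finset.mul_sum, ← Finset.mul_sum] at e6
  rw [e3] at e2
  replace e4 := Int.ofNat_le.2 e4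
  push_cast at e1 e2 e4 e6
  linarith

end

end ChainSystem

/-! ## Systems of chains given by lists of labels -/

theorem mem_zip_tail {L : List ℕ} {u v : ℕ} :
    (u, v) ∈ L.zip L.tail ↔ ∃ a, ∃ h : a + 1 < L.length, L[a] = u ∧ L[a + 1] = v := by
  rw [List.mem_iff_getElem]
  simp only [List.length_zip, List.length_tail, List.getElem_zip, List.getElem_tail, Prod.mk.injEq]
  constructor
  · rintro ⟨a, ha, h1, h2⟩
    exact ⟨a, by omega, h1, h2⟩
  · rintro ⟨a, ha, h1, h2⟩
    exact ⟨a, by omega, h1, h2⟩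

namespace ChainSystem

/-- The system of chains given by lists of labels `1, …, N`. -/
noncomputable def ofLists {N : ℕ} [NeZero N] {K : Type*} (C : K → List ℕ) (bar : K → K)
    (bar_bar : ∀ k, bar (bar k) = k) (mem_range : ∀ k, ∀ v ∈ C k, 1 ≤ v ∧ v ≤ N)
    (cover : ∀ v : Fin N, ∃ k, v.val + 1 ∈ C k)
    (unique : ∀ k k' v, v ∈ C k → v ∈ C k' → k = k') (nodup : ∀ k, (C k).Nodup)
    (mirror_eq : ∀ k, C (bar k) = mirror N (C k)) : ChainSystem N K :=
  -- Beyond the end of the list the value is the default 0, which requires `N ≠ 0`.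
  let vert : K → ℕ → Fin N := fun k a =>
    if h : a < (C k).length then ⟨(C k)[a] - 1, by
      have := mem_range k _ (List.getElem_mem h); omega⟩ else 0
  have vert_val : ∀ k a (h : a < (C k).length), (vert k a).val + 1 = (C k)[a] := fun k a h => by
    have := mem_range k _ (List.getElem_mem h)
    simp only [vert, dif_pos h]
    omega
  have chain_vert : ∀ k a, a < (C k).length → (cover (vert k a)).choose = k := fun k a h =>
    unique _ _ ((vert k a).val + 1) (cover (vert k a)).choose_spec
      (by rw [vert_val k a h]; exact List.getElem_mem h)
  have length_bar : ∀ k, (C (bar k)).length = (C k).length := fun k => by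
    rw [mirror_eq, mirror, List.length_map, List.length_reverse]
  { len := fun k => (C k).length
    vert := vert
    bar := bar
    chain := fun v => (cover v).choose
    pos := fun v => (C (cover v).choose).idxOf (v.val + 1)
    pos_lt := fun v => List.idxOf_lt_length_iff.2 (cover v).choose_spec
    vert_chain_pos := fun v => by
      have h := List.idxOf_lt_length_iff.2 (cover v).choose_spec
      have h1 := vert_val _ _ h
      rw [List.getElem_idxOf] at h1
      exact Fin.ext (by omega)
    chain_vert := chain_vert
    pos_vert := fun k a h => by
      rw [chain_vert k a h, vert_val k a h]
      exact (nodup k).idxOf_getElem a h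
    bar_bar := bar_bar
    len_bar := length_bar
    rev_vert := fun k a h => by
      have h' : (C k).length - 1 - a < (C (bar k)).length := by rw [length_bar]; omega
      have h1 := vert_val _ _ h'
      have h2 := vert_val k a h
      have h3 : (C (bar k))[(C k).length - 1 - a] = N + 1 - (C k)[a] := by
        simp only [mirror_eq, mirror, List.getElem_map, List.getElem_reverse]
        congr 2
        omega
      have := mem_range k _ (List.getElem_mem h)
      apply Fin.ext
      rw [Fin.val_rev]
      omega }

theorem ofLists_line_iff {N : ℕ} [NeZero N] {K : Type*} {C : K → List ℕ} {bar : K → K}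
    (bar_bar : ∀ k, bar (bar k) = k) (mem_range : ∀ k, ∀ v ∈ C k, 1 ≤ v ∧ v ≤ N)
    (cover : ∀ v : Fin N, ∃ k, v.val + 1 ∈ C k)
    (unique : ∀ k k' v, v ∈ C k → v ∈ C k' → k = k') (nodup : ∀ k, (C k).Nodup)
    (mirror_eq : ∀ k, C (bar k) = mirror N (C k)) (i j : Fin N) :
    let S := ofLists C bar bar_bar mem_range cover unique nodup mirror_eq
    (S.chain i = S.chain j ∧ S.pos j = S.pos i + 1) ↔
      ∃ k, (i.val + 1, j.val + 1) ∈ (C k).zip (C k).tail := by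
  intro S
  have hS : ∀ v : Fin N, ∃ h : S.pos v < (C (S.chain v)).length,
      (C (S.chain v))[S.pos v] = v.val + 1 := fun v =>
    ⟨S.pos_lt v, List.getElem_idxOf _⟩
  have hk : ∀ (v : Fin N) k, v.val + 1 ∈ C k → S.chain v = k := fun v k h =>
    unique _ _ (v.val + 1) (cover v).choose_spec h
  simp only [mem_zip_tail]
  constructor
  · rintro ⟨h1, h2⟩
    obtain ⟨hi, hi'⟩ := hS i
    obtain ⟨hj, hj'⟩ := hS j
    simp only [← h1, h2] at hj hj'
    exact ⟨S.chain i, S.pos i, hj, hi', hj'⟩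
  · rintro ⟨k, a, h, hi, hj⟩
    have h1 := hk i k (hi ▸ List.getElem_mem _)
    have h2 := hk j k (hj ▸ List.getElem_mem _)
    refine ⟨h1.trans h2.symm, ?_⟩
    have e1 : S.pos i = (C (S.chain i)).idxOf (i.val + 1) := rfl
    have e2 : S.pos j = (C (S.chain j)).idxOf (j.val + 1) := rfl
    rw [e1, e2, h1, h2, ← hi, ← hj, (nodup k).idxOf_getElem, (nodup k).idxOf_getElem]

theorem chain_ofLists_eq_iff {N : ℕ} [NeZero N] {K : Type*} {C : K → List ℕ} {bar : K → K}
    (bar_bar : ∀ k, bar (bar k) = k) (mem_range : ∀ k, ∀ v ∈ C k, 1 ≤ v ∧ v ≤ N)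
    (cover : ∀ v : Fin N, ∃ k, v.val + 1 ∈ C k)
    (unique : ∀ k k' v, v ∈ C k → v ∈ C k' → k = k') (nodup : ∀ k, (C k).Nodup)
    (mirror_eq : ∀ k, C (bar k) = mirror N (C k)) (v : Fin N) (k : K) :
    (ofLists C bar bar_bar mem_range cover unique nodup mirror_eq).chain v = k ↔
      v.val + 1 ∈ C k := by
  constructor
  · rintro rfl
    exact (cover v).choose_spec
  · exact fun h => unique _ _ (v.val + 1) (cover v).choose_spec h

variable {N : ℕ} {K : Type*} {S : ChainSystem N K}

theorem chain_rev (v : Fin N) : S.chain v.rev = S.bar (S.chain v) := by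
  have h := S.rev_vert _ _ (S.pos_lt v)
  have := S.pos_lt v
  rw [S.vert_chain_pos] at h
  rw [h, S.chain_vert _ _ (by rw [S.len_bar]; omega)]

theorem pos_rev (v : Fin N) : S.pos v.rev = S.len (S.chain v) - 1 - S.pos v := by
  have h := S.rev_vert _ _ (S.pos_lt v)
  have := S.pos_lt v
  rw [S.vert_chain_pos] at h
  rw [h, S.pos_vert _ _ (by rw [S.len_bar]; omega)]

variable {τ : Family} {l : List ℕ} {c : Option ℕ} {T : ChainSystem (dimVector l c).sum K}

theorem isLineMatrix_lineMatrix
    (hT : ∀ i j, (i.val + 1, j.val + 1) ∈ diagramLines τ l c ↔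
      T.chain i = T.chain j ∧ T.pos j = T.pos i + 1) :
    T.IsLineMatrix (lineMatrix τ l c) := by
  refine ⟨fun i j h => ?_, fun i j h1 h2 => ?_⟩
  · rw [← hT]
    by_contra h'
    exact h (by simp [lineMatrix, h'])
  · simp only [lineMatrix, Matrix.of_apply, if_pos ((hT i j).2 ⟨h1, h2⟩), lineSign]
    cases τ <;> split_ifs <;> norm_num

/-- The set of lines is mirror symmetric, so only signs matter. In so, counterparts need opposite
signs, which holds since their label sums lie on opposite sides of N + 1, provided that no line is
its own counterpart. -/
theorem lineMatrix_mem_classicalLie (hN : τ = .sp → Even (dimVector l c).sum)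
    (hT : ∀ i j, (i.val + 1, j.val + 1) ∈ diagramLines τ l c ↔
      T.chain i = T.chain j ∧ T.pos j = T.pos i + 1)
    (hso : τ = .so → ∀ k, T.bar k = k → T.len k = 0 ∨ Odd (T.len k)) :
    lineMatrix τ l c ∈ classicalLie τ (dimVector l c).sum := by
  rw [mem_classicalLie_iff]
  intro i j
  have h1 : (j.rev.val + 1, i.rev.val + 1) ∈ diagramLines τ l c ↔
      (i.val + 1, j.val + 1) ∈ diagramLines τ l c := by
    rw [hT, hT, chain_rev, chain_rev, pos_rev, pos_rev]
    have hi := T.pos_lt i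
    have hj := T.pos_lt j
    constructor
    · rintro ⟨h, h'⟩
      have h := congrArg T.bar h
      rw [T.bar_bar, T.bar_bar] at h
      rw [h] at h' hj
      exact ⟨h.symm, by omega⟩
    · rintro ⟨h, h'⟩
      rw [← h] at hj ⊢
      exact ⟨rfl, by omega⟩
  simp only [lineMatrix, Matrix.of_apply, h1]
  split_ifs with h
  · cases τ
    · have e1 : ∀ a b : Fin (dimVector l c).sum,
          lineSign .sp (dimVector l c).sum (a.val + 1) (b.val + 1) = formSign .sp a := fun a b => rfl
      rw [e1, e1, formSign_rev .sp hN]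
      simp only [familySign, Int.cast_one]
      linear_combination formSign .sp j * formSign_mul_self .sp i
    -- A line from a vertex to its own mirror image would be the middle line of a self-mirror chain
    -- of even length.
    · have h2 : i.val + j.val + 1 ≠ (dimVector l c).sum := by
        intro h2
        have hij : j = i.rev := by apply Fin.ext; rw [Fin.val_rev]; omega
        rw [hT, hij, chain_rev, pos_rev] at h
        have hi := T.pos_lt i
        rcases hso rfl _ h.1.symm with h3 | ⟨m, h3⟩ <;> omega
      have e1 : lineSign .so (dimVector l c).sum (i.val + 1) (j.val + 1) =
        if i.val + 1 + (j.val + 1) ≤ (dimVector l c).sum then 1 else -1 := rfl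
      have e2 : lineSign .so (dimVector l c).sum (j.rev.val + 1) (i.rev.val + 1) =
        if j.rev.val + 1 + (i.rev.val + 1) ≤ (dimVector l c).sum then 1 else -1 := rfl
      rw [e1, e2, Fin.val_rev, Fin.val_rev]
      simp only [formSign]
      split_ifs <;> first | omega | norm_num
  · rw [mul_zero]

end ChainSystem

/-! ## Positions in the left half -/

/-- The size of the block of sizes `l` that contains the position `a`. -/
def blockSize : List ℕ → ℕ → ℕ
  | [], _ => 0
  | x :: l, a => if a < x then x else blockSize l (a - x)

/-- The position of `a` within its block. -/
def blockOffset : List ℕ → ℕ → ℕ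
  | [], _ => 0
  | x :: l, a => if a < x then a else blockOffset l (a - x)

theorem blockSize_mem {l : List ℕ} : ∀ {a : ℕ}, a < l.sum → blockSize l a ∈ l := by
  induction l with
  | nil => simp
  | cons x l ih =>
    intro a ha
    rw [List.sum_cons] at ha
    simp only [blockSize]
    split_ifs with h
    · simp
    · exact List.mem_cons_of_mem _ (ih (by omega))

theorem blockOffset_lt {l : List ℕ} : ∀ {a : ℕ}, a < l.sum → blockOffset l a < blockSize l a := by
  induction l with
  | nil => simp
  | cons x l ih =>
    intro a ha
    rw [List.sum_cons] at ha
    simp only [blockSize, blockOffset]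
    split_ifs with h
    · exact h
    · exact ih (by omega)

theorem exists_blockOffset_eq {l : List ℕ} : ∀ {a : ℕ}, a < l.sum → ∀ {j : ℕ},
    j < blockSize l a → ∃ b < l.sum, blockIndex l b = blockIndex l a ∧
      blockSize l b = blockSize l a ∧ blockOffset l b = j := by
  induction l with
  | nil => simp
  | cons x l ih =>
    intro a ha j hj
    rw [List.sum_cons] at ha
    simp only [blockSize, blockIndex] at hj ⊢
    by_cases h : a < x
    · simp only [if_pos h] at hj ⊢
      exact ⟨j, by rw [List.sum_cons]; omega, by simp [hj], by simp [hj], by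
        simp [blockOffset, hj]⟩
    · simp only [if_neg h] at hj ⊢
      obtain ⟨b, hb, h1, h2, h3⟩ := ih (by omega : a - x < l.sum) hj
      have e : ¬ x + b < x := by omega
      refine ⟨x + b, by rw [List.sum_cons]; omega, ?_, ?_, ?_⟩ <;>
        simp only [blockOffset, if_neg e, Nat.add_sub_cancel_left, h1, h2, h3]

/-- This is how multiplicity one is used: such a length determines its column. -/
theorem blockIndex_eq_of_count_eq_one {l : List ℕ} : ∀ {a b : ℕ}, a < l.sum → b < l.sum →
    blockSize l a = blockSize l b → l.count (blockSize l a) = 1 →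
    blockIndex l a = blockIndex l b := by
  induction l with
  | nil => simp
  | cons x l ih =>
    intro a b ha hb hab hc
    rw [List.sum_cons] at ha hb
    simp only [blockSize, blockIndex] at hab hc ⊢
    have key : ∀ a, ¬ a < x → a < x + l.sum → blockSize l (a - x) = x →
        List.count x (x :: l) ≠ 1 := by
      intro a h1 h2 h3
      have h4 : x ∈ l := by
        have h5 : blockSize l (a - x) ∈ l := blockSize_mem (by omega)
        rwa [h3] at h5
      have := List.count_pos_iff.2 h4
      rw [List.count_cons_self]
      omega
    by_cases h : a < x <;> by_cases h' : b < x
    · simp only [if_pos h, if_pos h']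
    · simp only [if_pos h, if_neg h'] at hab hc
      exact absurd hc (key b h' hb hab.symm)
    · simp only [if_neg h, if_pos h'] at hab hc
      rw [hab] at hc
      exact absurd hc (key a h ha hab)
    · simp only [if_neg h, if_neg h'] at hab hc ⊢
      rw [ih (by omega) (by omega) hab]
      have h4 : blockSize l (a - x) ∈ l := blockSize_mem (by omega)
      have := List.count_pos_iff.2 h4
      rw [List.count_cons] at hc
      omega

/-- The vertices in columns of lengths `l`, labelled from `s`, whose position in their column is
prescribed by `ρ` in terms of the length of the column. -/
def leftChain (s : ℕ) (l : List ℕ) (ρ : ℕ → Option ℕ) : List ℕ :=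
  (columns s l).filterMap fun v => (ρ v.length).bind fun j => v[j]?

theorem leftChain_cons (s x : ℕ) (l : List ℕ) (ρ : ℕ → Option ℕ) :
    leftChain s (x :: l) ρ =
      ((ρ x).bind fun j => if j < x then some (s + j) else none).toList ++
        leftChain (s + x) l ρ := by
  have h : (fun j : ℕ => (List.range' s x)[j]?) = fun j => if j < x then some (s + j) else none := by
    ext1 j
    by_cases hj : j < x <;> simp [hj]
  simp only [leftChain, columns, List.filterMap_cons, List.length_range', h]
  cases (ρ x).bind fun j => if j < x then some (s + j) else none <;> rfl

theorem mem_leftChain {l : List ℕ} {ρ : ℕ → Option ℕ} : ∀ {s v : ℕ}, v ∈ leftChain s l ρ ↔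
    ∃ a < l.sum, v = s + a ∧ ρ (blockSize l a) = some (blockOffset l a) := by
  induction l with
  | nil => simp [leftChain, columns]
  | cons x l ih =>
    intro s v
    rw [leftChain_cons, List.mem_append, ih, Option.mem_toList,
      Option.bind_eq_some_iff]
    constructor
    · rintro (⟨j, hj, h⟩ | ⟨a, ha, rfl, h⟩)
      · split_ifs at h with hx
        · refine ⟨j, by rw [List.sum_cons]; omega, by simpa using h.symm, ?_⟩
          simp [blockSize, blockOffset, hx, hj]
      · have e : ¬ x + a < x := by omega
        refine ⟨x + a, by rw [List.sum_cons]; omega, by omega, ?_⟩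
        simpa only [blockSize, blockOffset, if_neg e, Nat.add_sub_cancel_left] using h
    · rintro ⟨a, ha, rfl, h⟩
      rw [List.sum_cons] at ha
      simp only [blockSize, blockOffset] at h
      by_cases hx : a < x
      · simp only [if_pos hx] at h
        exact Or.inl ⟨a, h, by rw [if_pos hx]⟩
      · simp only [if_neg hx] at h
        exact Or.inr ⟨a - x, by omega, by omega, h⟩

theorem leftChain_pairwise {l : List ℕ} {ρ : ℕ → Option ℕ} : ∀ {s : ℕ},
    (leftChain s l ρ).Pairwise fun u v => blockIndex l (u - s) < blockIndex l (v - s) := by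
  induction l with
  | nil => simp [leftChain, columns]
  | cons x l ih =>
    intro s
    rw [leftChain_cons, List.pairwise_append]
    refine ⟨?_, ?_, ?_⟩
    · cases (ρ x).bind fun j => if j < x then some (s + j) else none <;> simp
    · refine List.Pairwise.imp_of_mem ?_ (ih (s := s + x))
      intro u v hu hv h
      obtain ⟨a, _, rfl, _⟩ := mem_leftChain.1 hu
      obtain ⟨b, _, rfl, _⟩ := mem_leftChain.1 hv
      have ea : ¬ s + x + a - s < x := by omega
      have eb : ¬ s + x + b - s < x := by omega
      simp only [blockIndex, if_neg ea, if_neg eb, Nat.sub_sub]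
      omega
    · intro u hu v hv
      rw [Option.mem_toList, Option.bind_eq_some_iff] at hu
      obtain ⟨j, -, hj⟩ := hu
      obtain ⟨b, _, rfl, _⟩ := mem_leftChain.1 hv
      split_ifs at hj with hx
      have ea : u - s < x := by
        rw [← Option.some.inj hj]; omega
      have eb : ¬ s + x + b - s < x := by omega
      simp only [blockIndex, if_pos ea, if_neg eb]
      omega

theorem length_leftChain {l : List ℕ} {ρ : ℕ → Option ℕ} (hρ : ∀ x j, ρ x = some j → j < x) :
    ∀ {s : ℕ}, (leftChain s l ρ).length = l.countP fun x => (ρ x).isSome := by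
  induction l with
  | nil => simp [leftChain, columns]
  | cons x l ih =>
    intro s
    rw [leftChain_cons, List.length_append, ih, List.countP_cons, add_comm]
    congr 1
    rcases h : ρ x with _ | j
    · simp
    · simp [hρ x j h]

theorem countP_add_countP (p q : ℕ → Bool) (l : List ℕ) :
    l.countP p + l.countP q = 2 * l.countP (fun x => p x && q x) +
      l.countP fun x => (p x != q x) := by
  induction l with
  | nil => simp
  | cons x l ih =>
    simp only [List.countP_cons]
    rcases hp : p x <;> rcases hq : q x <;> simp <;> omega

/-! ## Blocks of palindromic dimension vectors -/

theorem sum_dimVector (l : List ℕ) (c : Option ℕ) :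
    (dimVector l c).sum = 2 * l.sum + c.getD 0 := by
  cases c <;> simp [dimVector] <;> omega

theorem reverse_dimVector (l : List ℕ) (c : Option ℕ) :
    (dimVector l c).reverse = dimVector l c := by
  cases c <;> simp [dimVector]

theorem length_dimVector (l : List ℕ) (c : Option ℕ) :
    (dimVector l c).length = 2 * l.length + c.toList.length := by
  simp [dimVector]; omega

theorem blockIndex_dimVector_left {l : List ℕ} (c : Option ℕ) {a : ℕ} (ha : a < l.sum) :
    blockIndex (dimVector l c) a = blockIndex l a := by
  rw [dimVector, List.append_assoc, blockIndex_append, if_pos ha]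

theorem blockIndex_dimVector_centre {l : List ℕ} {c : Option ℕ} {a : ℕ} (ha : l.sum ≤ a)
    (ha' : a < l.sum + c.getD 0) : blockIndex (dimVector l c) a = l.length := by
  cases c with
  | none => simp at ha'; omega
  | some c =>
    have h : a - l.sum < c := by simp at ha'; omega
    rw [dimVector, List.append_assoc, blockIndex_append, if_neg (by omega)]
    simp [blockIndex, h]

theorem blockIndex_dimVector_right {l : List ℕ} {c : Option ℕ} {a : ℕ} (ha : a < l.sum) :
    blockIndex (dimVector l c) (2 * l.sum + c.getD 0 - 1 - a) + blockIndex l a + 1 =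
      2 * l.length + c.toList.length := by
  have h := blockIndex_reverse (dimVector l c) (a := a) (by rw [sum_dimVector]; omega)
  rwa [reverse_dimVector, sum_dimVector, length_dimVector, blockIndex_dimVector_left c ha] at h

theorem mirror_append (N : ℕ) (A B : List ℕ) : mirror N (A ++ B) = mirror N B ++ mirror N A := by
  simp [mirror]

theorem mirror_mirror {N : ℕ} {A : List ℕ} (h : ∀ v ∈ A, v ≤ N + 1) : mirror N (mirror N A) = A := by
  simp only [mirror, ← List.map_reverse, List.reverse_reverse, List.map_map]
  conv_rhs => rw [← List.map_id A]
  refine List.map_congr_left fun v hv => ?_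
  have := h v hv
  simp only [Function.comp_apply, id]
  omega

theorem mem_mirror {N : ℕ} {A : List ℕ} {v : ℕ} :
    v ∈ mirror N A ↔ ∃ u ∈ A, v = N + 1 - u := by
  simp [mirror, eq_comm]

/-! ## Systems of chains given by the rows they visit -/

/-- A system of chains symmetric under the mirror map, in which every chain visits at most one
vertex of each column, in a row that depends only on the length of the column: in the columns on
the left the chain `k` visits row `row k x` (if any) of each column of length `x`, and in the
central column the row `ctr k` (if any); the chain `bar k` is its mirror image. -/
structure Selection (l : List ℕ) (c : ℕ) (K : Type*) where
  row : K → ℕ → Option ℕ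
  ctr : K → Option ℕ
  bar : K → K
  bar_bar : ∀ k, bar (bar k) = k
  row_lt : ∀ k x j, row k x = some j → j < x
  row_cover : ∀ x ∈ l, ∀ j < x, ∃ k, row k x = some j
  row_inj : ∀ x ∈ l, ∀ k k' j, row k x = some j → row k' x = some j → k = k'
  ctr_lt : ∀ k j, ctr k = some j → j < c
  ctr_cover : ∀ j < c, ∃ k, ctr k = some j
  ctr_inj : ∀ k k' j, ctr k = some j → ctr k' = some j → k = k'
  ctr_bar : ∀ k, ctr (bar k) = (ctr k).map fun j => c - 1 - j

namespace Selection

variable {l : List ℕ} {c : ℕ} {K : Type*} (R : Selection l c K)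

/-- The chain `k` as a list of labels. -/
def chain (k : K) : List ℕ :=
  leftChain 1 l (R.row k) ++ ((R.ctr k).map fun j => l.sum + 1 + j).toList ++
    mirror (2 * l.sum + c) (leftChain 1 l (R.row (R.bar k)))

/-- The chain `k` visits the position `a` (counted from `0`). -/
def Visits (k : K) (a : ℕ) : Prop :=
  if a < l.sum then R.row k (blockSize l a) = some (blockOffset l a)
  else if a < l.sum + c then R.ctr k = some (a - l.sum)
  else R.row (R.bar k) (blockSize l (2 * l.sum + c - 1 - a)) =
    some (blockOffset l (2 * l.sum + c - 1 - a))

/-- The chain `k` visits the column of the position `a` (counted from `0`). -/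
def VisitsBlock (k : K) (a : ℕ) : Prop :=
  if a < l.sum then (R.row k (blockSize l a)).isSome
  else if a < l.sum + c then (R.ctr k).isSome
  else (R.row (R.bar k) (blockSize l (2 * l.sum + c - 1 - a))).isSome

/-- Every column visited by the chain `k` is visited by the chain `k'`. -/
def Nested (k k' : K) : Prop :=
  (∀ x ∈ l, (R.row k x).isSome → (R.row k' x).isSome) ∧ ((R.ctr k).isSome → (R.ctr k').isSome) ∧
    ∀ x ∈ l, (R.row (R.bar k) x).isSome → (R.row (R.bar k') x).isSome

variable {R}

theorem mem_chain {k : K} {v : ℕ} :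
    v ∈ R.chain k ↔ ∃ a < 2 * l.sum + c, v = a + 1 ∧ R.Visits k a := by
  rw [chain, List.mem_append, List.mem_append, mem_leftChain, mem_mirror, Option.mem_toList,
    Option.map_eq_some_iff]
  constructor
  · rintro ((⟨a, ha, rfl, h⟩ | ⟨j, hj, rfl⟩) | ⟨u, hu, rfl⟩)
    · exact ⟨a, by omega, by omega, by rwa [Visits, if_pos ha]⟩
    · have := R.ctr_lt k j hj
      refine ⟨l.sum + j, by omega, by omega, ?_⟩
      rwa [Visits, if_neg (by omega), if_pos (by omega), Nat.add_sub_cancel_left]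
    · obtain ⟨a, ha, rfl, h⟩ := mem_leftChain.1 hu
      refine ⟨2 * l.sum + c - 1 - a, by omega, by omega, ?_⟩
      rwa [Visits, if_neg (by omega), if_neg (by omega),
        show 2 * l.sum + c - 1 - (2 * l.sum + c - 1 - a) = a by omega]
  · rintro ⟨a, ha, rfl, h⟩
    rw [Visits] at h
    split_ifs at h with h1 h2
    · exact Or.inl (Or.inl ⟨a, h1, by omega, h⟩)
    · exact Or.inl (Or.inr ⟨_, h, by omega⟩)
    · refine Or.inr ⟨1 + (2 * l.sum + c - 1 - a), ?_, by omega⟩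
      exact mem_leftChain.2 ⟨_, by omega, rfl, h⟩

theorem mem_chain_succ {k : K} {a : ℕ} (ha : a < 2 * l.sum + c) :
    a + 1 ∈ R.chain k ↔ R.Visits k a := by
  rw [mem_chain]
  constructor
  · rintro ⟨b, _, hb, h⟩
    rwa [Nat.succ.inj hb]
  · exact fun h => ⟨a, ha, rfl, h⟩

theorem exists_visits {a : ℕ} (ha : a < 2 * l.sum + c) : ∃ k, R.Visits k a := by
  simp only [Visits]
  split_ifs with h1 h2
  · exact R.row_cover _ (blockSize_mem h1) _ (blockOffset_lt h1)
  · exact R.ctr_cover _ (by omega)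
  · have h3 : 2 * l.sum + c - 1 - a < l.sum := by omega
    obtain ⟨k, hk⟩ := R.row_cover _ (blockSize_mem h3) _ (blockOffset_lt h3)
    exact ⟨R.bar k, by rwa [R.bar_bar]⟩

theorem visits_inj {k k' : K} {a : ℕ} (ha : a < 2 * l.sum + c) (h : R.Visits k a)
    (h' : R.Visits k' a) : k = k' := by
  rw [Visits] at h h'
  split_ifs at h h' with h1 h2
  · exact R.row_inj _ (blockSize_mem h1) _ _ _ h h'
  · exact R.ctr_inj _ _ _ h h'
  · have := R.row_inj _ (blockSize_mem (by omega)) _ _ _ h h'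
    rw [← R.bar_bar k, this, R.bar_bar]

theorem Visits.visitsBlock {k : K} {a : ℕ} (h : R.Visits k a) : R.VisitsBlock k a := by
  rw [Visits] at h
  rw [VisitsBlock]
  split_ifs at h ⊢ <;> simp [h]

theorem Nested.visitsBlock {k k' : K} (h : R.Nested k k') {a : ℕ} (ha : a < 2 * l.sum + c)
    (hk : R.VisitsBlock k a) : R.VisitsBlock k' a := by
  rw [VisitsBlock] at hk ⊢
  split_ifs at hk ⊢ with h1 h2
  · exact h.1 _ (blockSize_mem h1) hk
  · exact h.2.1 hk
  · exact h.2.2 _ (blockSize_mem (by omega)) hk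

theorem chain_bar (k : K) : R.chain (R.bar k) = mirror (2 * l.sum + c) (R.chain k) := by
  rw [chain, chain, R.bar_bar, mirror_append, mirror_append, mirror_mirror, List.append_assoc]
  · congr 2
    rw [R.ctr_bar]
    rcases h : R.ctr k with _ | j
    · simp [mirror]
    · have := R.ctr_lt k j h
      simp [mirror]
      omega
  · intro v hv
    obtain ⟨a, ha, rfl, -⟩ := mem_leftChain.1 hv
    omega

/-- The right half of `k` mirrors the left half of `bar k`. Columns visited by both halves count
twice, so the parity depends only on the other terms. -/
theorem length_chain (k : K) : (R.chain k).length =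
    2 * l.countP (fun x => (R.row k x).isSome && (R.row (R.bar k) x).isSome) +
      l.countP (fun x => ((R.row k x).isSome != (R.row (R.bar k) x).isSome)) +
        (R.ctr k).toList.length := by
  rw [← countP_add_countP, chain, List.length_append, List.length_append, mirror, List.length_map,
    List.length_reverse, length_leftChain (R.row_lt k), length_leftChain (R.row_lt _)]
  cases R.ctr k
  · simp
  · simp; omega

/-- Turns conditions on column lengths into membership of blocks: the prescribed row exists in the
column by `row_lt` or `ctr_lt`. -/
theorem exists_visits_of_visitsBlock {c : Option ℕ} {R : Selection l (c.getD 0) K} {k : K} {a : ℕ}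
    (ha : a < 2 * l.sum + c.getD 0) (h : R.VisitsBlock k a) :
    ∃ b < 2 * l.sum + c.getD 0, R.Visits k b ∧
      blockIndex (dimVector l c) b = blockIndex (dimVector l c) a := by
  rw [VisitsBlock] at h
  split_ifs at h with h1 h2
  · obtain ⟨j, hj⟩ := Option.isSome_iff_exists.1 h
    obtain ⟨b, hb, e1, e2, e3⟩ := exists_blockOffset_eq h1 (R.row_lt _ _ _ hj)
    refine ⟨b, by omega, ?_, ?_⟩
    · rw [Visits, if_pos hb, e2, e3, hj]
    · rw [blockIndex_dimVector_left c hb, blockIndex_dimVector_left c h1, e1]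
  · obtain ⟨j, hj⟩ := Option.isSome_iff_exists.1 h
    have := R.ctr_lt _ _ hj
    refine ⟨l.sum + j, by omega, ?_, ?_⟩
    · rw [Visits, if_neg (by omega), if_pos (by omega), hj, Nat.add_sub_cancel_left]
    · rw [blockIndex_dimVector_centre (by omega) (by omega),
        blockIndex_dimVector_centre (by omega) (by omega)]
  · obtain ⟨j, hj⟩ := Option.isSome_iff_exists.1 h
    obtain ⟨a', ha', rfl⟩ : ∃ a' < l.sum, a = 2 * l.sum + c.getD 0 - 1 - a' :=
      ⟨2 * l.sum + c.getD 0 - 1 - a, by omega, by omega⟩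
    have e0 : ∀ b < l.sum, 2 * l.sum + c.getD 0 - 1 - (2 * l.sum + c.getD 0 - 1 - b) = b := by
      intro b hb; omega
    rw [e0 a' ha'] at hj
    obtain ⟨b, hb, e1, e2, e3⟩ := exists_blockOffset_eq ha' (R.row_lt _ _ _ hj)
    refine ⟨2 * l.sum + c.getD 0 - 1 - b, by omega, ?_, ?_⟩
    · rw [Visits, if_neg (by omega), if_neg (by omega), e0 b hb, e2, e3, hj]
    · have f1 := blockIndex_dimVector_right (c := c) hb
      have f2 := blockIndex_dimVector_right (c := c) ha'
      omega

/-- Used twice: a chain has no repeated vertex, and X is strictly block upper triangular. The right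
half increases because mirroring reverses both the list and the block numbers. -/
theorem chain_pairwise {c : Option ℕ} {R : Selection l (c.getD 0) K} (k : K) :
    (R.chain k).Pairwise fun u v =>
      blockIndex (dimVector l c) (u - 1) < blockIndex (dimVector l c) (v - 1) := by
  have hl : ∀ k, (leftChain 1 l (R.row k)).Pairwise fun u v =>
      blockIndex l (u - 1) < blockIndex l (v - 1) := fun k => leftChain_pairwise
  have hm : ∀ a < l.sum, ∃ b, b = blockIndex (dimVector l c) (2 * l.sum + c.getD 0 + 1 - (1 + a) - 1)
      ∧ b + blockIndex l a + 1 = 2 * l.length + c.toList.length := by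
    intro a ha
    refine ⟨_, rfl, ?_⟩
    rw [show 2 * l.sum + c.getD 0 + 1 - (1 + a) - 1 = 2 * l.sum + c.getD 0 - 1 - a by omega]
    exact blockIndex_dimVector_right ha
  rw [chain, List.pairwise_append, List.pairwise_append]
  refine ⟨⟨?_, ?_, ?_⟩, ?_, ?_⟩
  · refine List.Pairwise.imp_of_mem ?_ (hl k)
    intro u v hu hv h
    obtain ⟨a, ha, rfl, _⟩ := mem_leftChain.1 hu
    obtain ⟨b, hb, rfl, _⟩ := mem_leftChain.1 hv
    rwa [Nat.add_sub_cancel_left, Nat.add_sub_cancel_left, blockIndex_dimVector_left c ha,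
      blockIndex_dimVector_left c hb, ← Nat.add_sub_cancel_left (n := 1) (m := a),
      ← Nat.add_sub_cancel_left (n := 1) (m := b)]
  · cases R.ctr k <;> simp
  · intro u hu v hv
    obtain ⟨a, ha, rfl, _⟩ := mem_leftChain.1 hu
    rw [Option.mem_toList, Option.map_eq_some_iff] at hv
    obtain ⟨j, hj, rfl⟩ := hv
    have := R.ctr_lt _ _ hj
    rw [Nat.add_sub_cancel_left, blockIndex_dimVector_left c ha,
      blockIndex_dimVector_centre (by omega) (by omega)]
    exact blockIndex_lt l ha
  · rw [mirror, List.pairwise_map, List.pairwise_reverse]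
    refine List.Pairwise.imp_of_mem ?_ (hl (R.bar k))
    intro u v hu hv h
    obtain ⟨a, ha, rfl, _⟩ := mem_leftChain.1 hu
    obtain ⟨b, hb, rfl, _⟩ := mem_leftChain.1 hv
    obtain ⟨x, hx, hx'⟩ := hm a ha
    obtain ⟨y, hy, hy'⟩ := hm b hb
    rw [Nat.add_sub_cancel_left, Nat.add_sub_cancel_left] at h
    rw [← hx, ← hy]
    omega
  · intro u hu v hv
    obtain ⟨w, hw, rfl⟩ := mem_mirror.1 hv
    obtain ⟨a, ha, rfl, _⟩ := mem_leftChain.1 hw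
    obtain ⟨x, hx, hx'⟩ := hm a ha
    have ha' := blockIndex_lt l ha
    rw [← hx]
    rcases List.mem_append.1 hu with hu | hu
    · obtain ⟨b, hb, rfl, _⟩ := mem_leftChain.1 hu
      have hb' := blockIndex_lt l hb
      rw [Nat.add_sub_cancel_left, blockIndex_dimVector_left c hb]
      omega
    · rw [Option.mem_toList, Option.map_eq_some_iff] at hu
      obtain ⟨j, hj, rfl⟩ := hu
      have := R.ctr_lt _ _ hj
      rw [blockIndex_dimVector_centre (by omega) (by omega)]
      cases c with
      | none => simp at this
      | some c => simp at hx'; omega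

end Selection

/-! ### The Richardson criterion in terms of visited rows. -/

namespace Selection

variable {l : List ℕ} {c : Option ℕ} {K : Type*}

theorem central_iff (a : Fin (dimVector l c).sum) :
    block (dimVector l c) a = block (dimVector l c) a.rev ↔
      l.sum ≤ a.val ∧ a.val < l.sum + c.getD 0 := by
  have hs := sum_dimVector l c
  have h := block_rev (reverse_dimVector l c) a
  rw [length_dimVector] at h
  have ha := a.isLt
  rcases lt_or_ge a.val l.sum with h1 | h1
  · have h2 := blockIndex_lt l h1
    rw [← blockIndex_dimVector_left c h1] at h2
    change block _ a < _ at h2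
    omega
  · rcases lt_or_ge a.val (l.sum + c.getD 0) with h2 | h2
    · have h3 := blockIndex_dimVector_centre h1 h2
      change block _ a = _ at h3
      cases c with
      | none => simp at h2; omega
      | some c => simp at h h2 ⊢; omega
    · have h3 : a.rev.val < l.sum := by rw [Fin.val_rev]; omega
      have h4 := blockIndex_lt l h3
      rw [← blockIndex_dimVector_left c h3] at h4
      change block _ a.rev < _ at h4
      omega

/-- A sufficient condition, in terms of the rows visited by the chains, for the matrix of a line
diagram to be a Richardson element. -/
theorem isRichardson_lineMatrix [Fintype K] {τ : Family} (R : Selection l (c.getD 0) K)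
    (hN : τ = .sp → Even (dimVector l c).sum)
    (hlines : ∀ p, p ∈ diagramLines τ l c ↔ ∃ k, p ∈ (R.chain k).zip (R.chain k).tail)
    (hso : τ = .so → ∀ k, R.bar k = k → R.chain k = [] ∨ (R.ctr k).isSome)
    (hnest : ∀ k k', k' ≠ R.bar k → R.Nested k k' ∨ R.Nested k' k)
    (hself : ∀ k, (∀ x ∈ l, (R.row k x).isSome = (R.row (R.bar k) x).isSome) ∨
      ∃ x₀, l.count x₀ = 1 ∧
        (∀ x ∈ l, x ≠ x₀ → (R.row k x).isSome = (R.row (R.bar k) x).isSome) ∧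
        (R.row k x₀).isSome ≠ (R.row (R.bar k) x₀).isSome ∧ ((R.ctr k).isSome ↔ τ = .sp)) :
    IsRichardson τ (dimVector l c) (lineMatrix τ l c) ∧
      Module.finrank ℂ (centralizer τ (lineMatrix τ l c)) =
        Module.finrank ℂ (leviFactor τ (dimVector l c)) := by
  classical
  have hd := reverse_dimVector l c
  have hs := sum_dimVector l c
  -- `ofLists` needs N ≠ 0; for N = 0 all matrices coincide.
  rcases Nat.eq_zero_or_pos (dimVector l c).sum with h0 | h0
  · have : IsEmpty (Fin (dimVector l c).sum) := by rw [h0]; infer_instance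
    refine isRichardson_of_finrank_centralizer_le hN hd ?_ ?_
    · rw [Subsingleton.elim (lineMatrix τ l c) 0]
      exact zero_mem _
    · rw [Module.finrank_zero_of_subsingleton]
      exact Nat.zero_le _
  have : NeZero (dimVector l c).sum := ⟨h0.ne'⟩
  have hmem : ∀ k, ∀ v ∈ R.chain k, 1 ≤ v ∧ v ≤ (dimVector l c).sum := by
    intro k v hv
    obtain ⟨a, ha, rfl, -⟩ := mem_chain.1 hv
    omega
  have hsucc : ∀ k (a : Fin (dimVector l c).sum), a.val + 1 ∈ R.chain k ↔ R.Visits k a :=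
    fun k a => mem_chain_succ (by have := a.isLt; omega)
  have hcover : ∀ v : Fin (dimVector l c).sum, ∃ k, v.val + 1 ∈ R.chain k := by
    intro v
    simp only [hsucc]
    exact exists_visits (by have := v.isLt; omega)
  have hunique : ∀ k k' v, v ∈ R.chain k → v ∈ R.chain k' → k = k' := by
    intro k k' v h h'
    obtain ⟨a, ha, rfl, h1⟩ := mem_chain.1 h
    rw [mem_chain_succ ha] at h'
    exact visits_inj ha h1 h'
  have hnodup : ∀ k, (R.chain k).Nodup := fun k =>
    (chain_pairwise k).imp fun h h' => by rw [h'] at h; exact lt_irrefl _ h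
  have hmirror : ∀ k, R.chain (R.bar k) = mirror (dimVector l c).sum (R.chain k) := fun k => by
    rw [hs]; exact chain_bar k
  let S := ChainSystem.ofLists R.chain R.bar R.bar_bar hmem hcover hunique hnodup hmirror
  have hchain : ∀ v k, S.chain v = k ↔ R.Visits k v := fun v k => by
    rw [← hsucc]
    exact ChainSystem.chain_ofLists_eq_iff R.bar_bar hmem hcover hunique hnodup hmirror v k
  have hline : ∀ i j, (i.val + 1, j.val + 1) ∈ diagramLines τ l c ↔
      S.chain i = S.chain j ∧ S.pos j = S.pos i + 1 := fun i j => by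
    rw [hlines]
    exact (ChainSystem.ofLists_line_iff R.bar_bar hmem hcover hunique hnodup hmirror i j).symm
  have hlen : ∀ k, S.len k = (R.chain k).length := fun k => rfl
  have hX := ChainSystem.isLineMatrix_lineMatrix hline
  have hXc : lineMatrix τ l c ∈ classicalLie τ (dimVector l c).sum := by
    refine ChainSystem.lineMatrix_mem_classicalLie hN hline fun hτ k hk => ?_
    change R.bar k = k at hk
    rw [hlen]
    rcases hso hτ k hk with h | h
    · exact Or.inl (by rw [h, List.length_nil])
    · obtain ⟨j, hj⟩ := Option.isSome_iff_exists.1 h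
      right
      rw [length_chain, hj, hk]
      simp
  have hn : lineMatrix τ l c ∈ nilradical τ (dimVector l c) := by
    refine ⟨hXc, fun a b hab => ?_⟩
    by_contra h
    have h1 := (hline a b).2 (hX.line_of_ne_zero _ _ h)
    rw [hlines] at h1
    obtain ⟨k, hk⟩ := h1
    obtain ⟨i, hi, e1, e2⟩ := mem_zip_tail.1 hk
    have h2 := List.pairwise_iff_getElem.1 (chain_pairwise (R := R) k) i (i + 1) (by omega) hi
      (by omega)
    rw [e1, e2, Nat.add_sub_cancel, Nat.add_sub_cancel] at h2
    exact absurd hab (not_le.2 h2)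
  have hocc : ∀ (i : Fin (dimVector l c).sum) k, R.VisitsBlock k i →
      block (dimVector l c) i ∈ S.blocks k := by
    intro i k h
    obtain ⟨b, hb, h1, h2⟩ := exists_visits_of_visitsBlock (by have := i.isLt; omega) h
    exact ChainSystem.mem_blocks.2 ⟨⟨b, by omega⟩, (hchain _ _).2 h1, h2⟩
  have hsub : ∀ k k', R.Nested k k' → S.blocks k ⊆ S.blocks k' := by
    intro k k' h b hb
    obtain ⟨i, hi, rfl⟩ := ChainSystem.mem_blocks.1 hb
    exact hocc i k' (h.visitsBlock (by have := i.isLt; omega) ((hchain _ _).1 hi).visitsBlock)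
  have hcard : ∀ k, #(S.blocks k) = S.len k := fun k => hX.card_blocks hn k
  have hctr : ∀ k, S.centralCard k = (R.ctr k).toList.length := by
    intro k
    rw [ChainSystem.centralCard]
    rcases h : R.ctr k with _ | j
    · rw [Finset.card_eq_zero.2, Option.toList_none, List.length_nil]
      refine Finset.filter_eq_empty_iff.2 fun i _ => ?_
      rintro ⟨h1, h2⟩
      rw [central_iff] at h2
      rw [hchain, Visits, if_neg (by omega), if_pos h2.2, h] at h1
      simp at h1
    · have hj := R.ctr_lt k j h
      rw [Option.toList_some, List.length_singleton, Finset.card_eq_one]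
      refine ⟨⟨l.sum + j, by omega⟩, ?_⟩
      ext i
      rw [mem_filter, central_iff, hchain, mem_singleton, Fin.ext_iff]
      constructor
      · rintro ⟨-, h1, h2⟩
        rw [Visits, if_neg (by omega), if_pos h2.2, h] at h1
        have := Option.some.inj h1
        change i.val = l.sum + j
        omega
      · intro hi
        change i.val = l.sum + j at hi
        refine ⟨mem_univ _, ?_, by omega⟩
        rw [Visits, if_neg (by omega), if_pos (by omega), h, hi, Nat.add_sub_cancel_left]
  refine isRichardson_of_finrank_centralizer_le hN hd hn
    (hX.finrank_centralizer_le hN hd hn (fun k k' hk => ?_) fun k => ?_)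
  · rcases hnest k k' hk with h | h
    · rw [Finset.inter_eq_left.2 (hsub k k' h), hcard]
      exact min_le_left _ _
    · rw [Finset.inter_eq_right.2 (hsub k' k h), hcard]
      exact min_le_right _ _
  · change _ ≤ (#(S.blocks k ∩ S.blocks (R.bar k)) : ℤ) + _
    have hbar : (R.ctr (R.bar k)).isSome = (R.ctr k).isSome := by
      rw [R.ctr_bar, Option.isSome_map]
    have hl := length_chain (R := R) k
    rw [← hlen] at hl
    have hc1 : (R.ctr k).toList.length = if (R.ctr k).isSome then 1 else 0 := by
      cases R.ctr k <;> rfl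
    rw [hctr, hc1]
    rw [hc1] at hl
    rcases hself k with h | ⟨x₀, h1, h2, h3, h4⟩
    · have e1 : R.Nested k (R.bar k) :=
        ⟨fun x hx => by rw [h x hx]; exact id, by rw [hbar]; exact id,
          fun x hx => by rw [R.bar_bar, h x hx]; exact id⟩
      have e2 : l.countP (fun x => ((R.row k x).isSome != (R.row (R.bar k) x).isSome)) = 0 := by
        rw [List.countP_eq_zero]
        intro x hx
        simp [h x hx]
      rw [Finset.inter_eq_left.2 (hsub _ _ e1), hcard]
      have e3 : S.len k % 2 = if (R.ctr k).isSome then 1 else 0 := by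
        rw [e2] at hl
        split_ifs at hl ⊢ <;> omega
      rw [e3]
    · have e2 : l.countP (fun x => ((R.row k x).isSome != (R.row (R.bar k) x).isSome)) = 1 := by
        rw [← h1, List.count]
        refine List.countP_congr fun x hx => ?_
        by_cases hx0 : x = x₀
        · subst hx0
          simpa using h3
        · simp [h2 x hx hx0, hx0]
      have e3 : S.len k ≤ #(S.blocks k ∩ S.blocks (R.bar k)) + 1 := by
        rw [← hcard, ← Finset.card_inter_add_card_sdiff (S.blocks k) (S.blocks (R.bar k))]
        refine Nat.add_le_add_left (Finset.card_le_one.2 ?_) _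
        -- A missed block is a column of length `x₀`, on the left if `k` visits that length and on
        -- the right if `bar k` does. By `h3` only one side occurs, and there the column is unique.
        have hdiff : ∀ b ∈ S.blocks k \ S.blocks (R.bar k), ∃ i : Fin (dimVector l c).sum,
            block (dimVector l c) i = b ∧
            ((i.val < l.sum ∧ blockSize l i = x₀ ∧ (R.row k x₀).isSome) ∨
              (i.rev.val < l.sum ∧ blockSize l i.rev = x₀ ∧ (R.row (R.bar k) x₀).isSome)) := by
          intro b hb
          rw [mem_sdiff] at hb
          obtain ⟨i, hi, rfl⟩ := ChainSystem.mem_blocks.1 hb.1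
          have hi1 := ((hchain _ _).1 hi).visitsBlock
          have hi2 : ¬ R.VisitsBlock (R.bar k) i := fun h => hb.2 (hocc i _ h)
          have hi3 := i.isLt
          refine ⟨i, rfl, ?_⟩
          rw [VisitsBlock] at hi1 hi2
          split_ifs at hi1 hi2 with g1 g2
          · left
            have : blockSize l i = x₀ := by
              by_contra hne
              rw [← h2 _ (blockSize_mem g1) hne] at hi2
              exact hi2 hi1
            exact ⟨g1, this, this ▸ hi1⟩
          · rw [hbar] at hi2
            exact absurd hi1 hi2
          · right
            have hr : 2 * l.sum + c.getD 0 - 1 - i.val = i.rev.val := by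
              rw [Fin.val_rev]; omega
            rw [hr] at hi1 hi2
            rw [R.bar_bar] at hi2
            have hlt : i.rev.val < l.sum := by omega
            have : blockSize l i.rev = x₀ := by
              by_contra hne
              rw [h2 _ (blockSize_mem hlt) hne] at hi2
              exact hi2 hi1
            exact ⟨hlt, this, this ▸ hi1⟩
        intro b hb b' hb'
        obtain ⟨i, rfl, hi⟩ := hdiff b hb
        obtain ⟨j, rfl, hj⟩ := hdiff b' hb'
        have key : ∀ i j : Fin (dimVector l c).sum, i.val < l.sum → j.val < l.sum →
            blockSize l i = x₀ → blockSize l j = x₀ →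
            block (dimVector l c) i = block (dimVector l c) j := by
          intro i j hi hj hi' hj'
          rw [block, block, blockIndex_dimVector_left c hi, blockIndex_dimVector_left c hj]
          exact blockIndex_eq_of_count_eq_one hi hj (hi'.trans hj'.symm) (by rw [hi', h1])
        rcases hi with ⟨g1, g2, g3⟩ | ⟨g1, g2, g3⟩ <;> rcases hj with ⟨f1, f2, f3⟩ | ⟨f1, f2, f3⟩
        · exact key i j g1 f1 g2 f2
        · exact absurd (g3.trans f3.symm) h3
        · exact absurd (f3.trans g3.symm) h3
        · have := key _ _ g1 f1 g2 f2
          have hi := block_rev hd i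
          have hj := block_rev hd j
          omega
      rw [e2] at hl
      -- The missing block is offset in sp by the central vertex (the length being even), and in so
      -- by the parity term -1 (the length being odd).
      cases τ
      · rw [if_pos (h4.2 rfl)] at hl ⊢
        have e4 : S.len k % 2 = 0 := by omega
        rw [e4]
        simp only [familySign]
        omega
      · have hc0 : ¬ (R.ctr k).isSome := fun h => by simpa using h4.1 h
        rw [if_neg hc0] at hl ⊢
        have e4 : S.len k % 2 = 1 := by omega
        rw [e4]
        simp only [familySign]
        omega

end Selection

/-! ## The diagrams of type (a) -/

theorem filterMap_columns {s : ℕ} {l : List ℕ} {f : List ℕ → Option ℕ} {ρ : ℕ → Option ℕ}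
    (h : ∀ v, f v = (ρ v.length).bind fun j => v[j]?) :
    (columns s l).filterMap f = leftChain s l ρ := by
  rw [leftChain, funext h]

theorem le_sum_of_mem {l : List ℕ} {x : ℕ} (h : x ∈ l) : x ≤ l.sum :=
  List.single_le_sum (fun _ _ => Nat.zero_le _) x h

theorem row_columns (s : ℕ) (l : List ℕ) (k : ℕ) :
    row (columns s l) k = leftChain s l fun x => if k < x then some k else none :=
  filterMap_columns fun v => by
    by_cases h : k < v.length <;> simp [h]

/-- The index type may contain labels absent from the diagram, as long as their lists are empty and
carry no lines. -/
theorem mem_diagramLines_iff {τ : Family} {l : List ℕ} {c : Option ℕ} {K : Type*}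
    {C : K → List ℕ} (h : ∀ k, C k ∈ chains τ l c ∨ C k = [])
    (h' : ∀ L ∈ chains τ l c, ∃ k, C k = L) (p : ℕ × ℕ) :
    p ∈ diagramLines τ l c ↔ ∃ k, p ∈ (C k).zip (C k).tail := by
  rw [diagramLines, List.mem_flatMap]
  constructor
  · rintro ⟨L, hL, hp⟩
    obtain ⟨k, rfl⟩ := h' L hL
    exact ⟨k, hp⟩
  · rintro ⟨k, hp⟩
    rcases h k with h | h
    · exact ⟨_, h, hp⟩
    · rw [h] at hp
      simp at hp

/-- The chains of the diagram of type (a) in the symplectic case. -/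
def evenSpSelection (l : List ℕ) : Selection l 0 (Fin (2 * l.sum)) where
  row k x := if k.val < x then some k.val else none
  ctr _ := none
  bar k := k
  bar_bar _ := rfl
  row_lt k x j h := by
    split_ifs at h with h'
    rwa [← Option.some.inj h]
  row_cover x hx j hj := ⟨⟨j, by have := le_sum_of_mem hx; omega⟩, by simp [hj]⟩
  row_inj x _ k k' j h h' := by
    split_ifs at h h'
    exact Fin.ext ((Option.some.inj h).trans (Option.some.inj h').symm)
  ctr_lt _ _ h := by simp at h
  ctr_cover j hj := absurd hj (Nat.not_lt_zero j)
  ctr_inj _ _ _ h := by simp at h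
  ctr_bar _ := rfl

theorem even_sum_dimVector {l : List ℕ} {c : Option ℕ} (hc : Even (c.getD 0)) :
    Even (dimVector l c).sum := by
  rw [sum_dimVector]
  exact (even_two_mul _).add hc

theorem isRichardson_evenSp (l : List ℕ) :
    IsRichardson .sp (dimVector l none) (lineMatrix .sp l none) ∧
      Module.finrank ℂ (centralizer .sp (lineMatrix .sp l none)) =
        Module.finrank ℂ (leviFactor .sp (dimVector l none)) := by
  have hchain : ∀ k, (evenSpSelection l).chain k = row (columns 1 l) k.val ++
      mirror (2 * l.sum) (row (columns 1 l) k.val) := by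
    intro k
    rw [row_columns, Selection.chain]
    simp [evenSpSelection]
  refine Selection.isRichardson_lineMatrix (c := none) (evenSpSelection l)
    (fun _ => even_sum_dimVector (by simp))
    (mem_diagramLines_iff (fun k => Or.inl ?_) fun L hL => ?_) (by simp) ?_ fun k => Or.inl fun _ _ => rfl
  · rw [hchain]
    exact List.mem_map.2 ⟨k, List.mem_range.2 k.isLt, rfl⟩
  · obtain ⟨k, hk, rfl⟩ := List.mem_map.1 hL
    exact ⟨⟨k, List.mem_range.1 hk⟩, hchain _⟩
  · intro k k' _
    -- In top-adjusted columns a lower row meets only columns met by every higher row.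
    have key : ∀ k k' : Fin (2 * l.sum), k ≤ k' → (evenSpSelection l).Nested k' k := by
      intro k k' h
      have h1 : ∀ x, ((evenSpSelection l).row k' x).isSome → ((evenSpSelection l).row k x).isSome := by
        intro x
        simp only [evenSpSelection]
        split_ifs <;> simp
        omega
      exact ⟨fun x _ => h1 x, id, fun x _ => h1 x⟩
    rcases le_total k k' with h | h
    · exact Or.inr (key _ _ h)
    · exact Or.inl (key _ _ h)

/-- The chains of the diagram of type (a) in the orthogonal case. -/
def evenSoSelection (l : List ℕ) : Selection l 0 (Fin (2 * l.sum) × Bool) where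
  row k x := if 2 * k.1.val + k.2.toNat < x then some (2 * k.1.val + k.2.toNat) else none
  ctr _ := none
  bar k := (k.1, !k.2)
  bar_bar k := by simp
  row_lt k x j h := by
    split_ifs at h with h'
    rwa [← Option.some.inj h]
  row_cover x hx j hj := by
    have := le_sum_of_mem hx
    have h1 : j / 2 < 2 * l.sum := by omega
    rcases Nat.mod_two_eq_zero_or_one j with h | h
    · have h2 : 2 * (j / 2) = j := by omega
      exact ⟨(⟨j / 2, h1⟩, false), by simp [h2, hj]⟩
    · have h2 : 2 * (j / 2) + 1 = j := by omega
      exact ⟨(⟨j / 2, h1⟩, true), by simp [h2, hj]⟩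
  row_inj x _ k k' j h h' := by
    obtain ⟨t, b⟩ := k
    obtain ⟨t', b'⟩ := k'
    split_ifs at h h'
    have h := (Option.some.inj h).trans (Option.some.inj h').symm
    cases b <;> cases b' <;> simp only [Bool.toNat_false, Bool.toNat_true] at h <;>
      simp [Fin.ext_iff] <;> omega
  ctr_lt _ _ h := by simp at h
  ctr_cover j hj := absurd hj (Nat.not_lt_zero j)
  ctr_inj _ _ _ h := by simp at h
  ctr_bar _ := rfl

theorem isSome_evenSo {l : List ℕ} (t : Fin (2 * l.sum)) (b : Bool) (x : ℕ) :
    ((evenSoSelection l).row (t, b) x).isSome ↔ 2 * t.val + b.toNat < x := by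
  simp only [evenSoSelection]
  split_ifs <;> simp_all

theorem isRichardson_evenSo {l : List ℕ} (h : IsSimple .so l none) :
    IsRichardson .so (dimVector l none) (lineMatrix .so l none) ∧
      Module.finrank ℂ (centralizer .so (lineMatrix .so l none)) =
        Module.finrank ℂ (leviFactor .so (dimVector l none)) := by
  have hchain : ∀ k, (evenSoSelection l).chain k =
      row (columns 1 l) (2 * k.1.val + k.2.toNat) ++
        mirror (2 * l.sum) (row (columns 1 l) (2 * k.1.val + (!k.2).toNat)) := by
    intro k
    rw [row_columns, row_columns, Selection.chain]
    simp [evenSoSelection]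
  refine Selection.isRichardson_lineMatrix (c := none) (evenSoSelection l) (by simp)
    (mem_diagramLines_iff (fun k => Or.inl ?_) fun L hL => ?_) ?_ ?_ ?_
  · rw [hchain]
    refine List.mem_flatMap.2 ⟨k.1, List.mem_range.2 k.1.isLt, ?_⟩
    rcases k with ⟨t, _ | _⟩ <;> simp
  · obtain ⟨t, ht, hL⟩ := List.mem_flatMap.1 hL
    rcases List.mem_pair.1 hL with rfl | rfl
    · exact ⟨(⟨t, List.mem_range.1 ht⟩, false), hchain _⟩
    · exact ⟨(⟨t, List.mem_range.1 ht⟩, true), hchain _⟩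
  · rintro - ⟨t, b⟩ hk
    simp [evenSoSelection] at hk
  · rintro ⟨t, b⟩ ⟨t', b'⟩ hk
    have key : ∀ (t t' : Fin (2 * l.sum)) (b b' : Bool), (t < t' ∨ t = t' ∧ b = b') →
        (evenSoSelection l).Nested (t', b') (t, b) := by
      intro t t' b b' h
      refine ⟨fun x _ => ?_, id, fun x _ => ?_⟩
      · rw [isSome_evenSo, isSome_evenSo]
        rcases h with h | ⟨rfl, rfl⟩
        · have := Bool.toNat_lt b
          omega
        · exact id
      · change ((evenSoSelection l).row (t', !b') x).isSome →
          ((evenSoSelection l).row (t, !b) x).isSome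
        rw [isSome_evenSo, isSome_evenSo]
        rcases h with h | ⟨rfl, rfl⟩
        · have := Bool.toNat_lt (!b)
          omega
        · exact id
    rcases lt_trichotomy t t' with h | rfl | h
    · exact Or.inr (key _ _ _ _ (Or.inl h))
    · refine Or.inl (key _ _ _ _ (Or.inr ⟨rfl, ?_⟩))
      by_contra hb
      exact hk (by cases b <;> cases b' <;> simp_all [evenSoSelection])
    · exact Or.inl (key _ _ _ _ (Or.inl h))
  · rintro ⟨t, b⟩
    have key : ∀ x, x ≠ 2 * t.val + 1 → ((evenSoSelection l).row (t, b) x).isSome =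
        ((evenSoSelection l).row ((evenSoSelection l).bar (t, b)) x).isSome := by
      intro x hx
      rw [Bool.eq_iff_iff]
      change _ ↔ ((evenSoSelection l).row (t, !b) x).isSome = true
      rw [isSome_evenSo, isSome_evenSo]
      cases b <;> simp <;> omega
    -- The two rows of a pair differ only in columns of length 2t + 1. This length is odd, so it
    -- appears twice in d and once in its left half.
    by_cases hx : 2 * t.val + 1 ∈ l
    · refine Or.inr ⟨2 * t.val + 1, ?_, fun x _ => key x, ?_, by simp [evenSoSelection]⟩
      · have := h (2 * t.val + 1) (by simp [dimVector, hx]) ⟨_, rfl⟩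
        simp only [dimVector, Option.toList_none, List.append_nil, List.count_append,
          List.count_reverse] at this
        omega
      · change ((evenSoSelection l).row (t, b) _).isSome ≠ ((evenSoSelection l).row (t, !b) _).isSome
        rw [Ne, Bool.eq_iff_iff, isSome_evenSo, isSome_evenSo]
        cases b <;> simp
    · exact Or.inl fun x hx' => key x (by rintro rfl; exact hx hx')

/-! ## The diagrams of type (b) -/

/-- The position in a list of its `u`-th remaining entry when the entry at `s` (if any) is removed. -/
def skip : Option ℕ → ℕ → ℕ
  | none, u => u
  | some s, u => if u < s then u else u + 1

/-- The number of remaining entries of a list of length `x` without the entry at `σ x`. -/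
def offLength (σ : ℕ → Option ℕ) (x : ℕ) : ℕ := x - (σ x).toList.length

/-- The row visited in a column of length `x` by the chain through the rows `σ x` (`none`), and in
round `t` by the chain of topmost (`false`) and of lowest (`true`) vertices off this chain. -/
def roundRow (σ : ℕ → Option ℕ) : Option (ℕ × Bool) → ℕ → Option ℕ
  | none, x => σ x
  | some (t, false), x => if 2 * t + 1 ≤ offLength σ x then some (skip (σ x) t) else none
  | some (t, true), x =>
    if 2 * t + 2 ≤ offLength σ x then some (skip (σ x) (offLength σ x - 1 - t)) else none

/-- The rows of the central column of length `c` visited by these chains. -/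
def roundCtr (c : ℕ) : Option (ℕ × Bool) → Option ℕ
  | none => if Odd c then some (c / 2) else none
  | some (t, false) => if 2 * t + 2 ≤ c then some t else none
  | some (t, true) => if 2 * t + 2 ≤ c then some (c - 1 - t) else none

/-- The mirror images of these chains: in a round `t` with `flip t`, the two chains of the round are
mirror images of each other, otherwise they are their own mirror images. -/
def roundBar (flip : ℕ → Bool) : Option (ℕ × Bool) → Option (ℕ × Bool)
  | none => none
  | some (t, b) => some (t, b ^^ flip t)

theorem skip_ne (s u : ℕ) : skip (some s) u ≠ s := by
  simp only [skip]
  split_ifs <;> omega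

theorem skip_inj {s : Option ℕ} {u u' : ℕ} (h : skip s u = skip s u') : u = u' := by
  cases s with
  | none => exact h
  | some s =>
    simp only [skip] at h
    split_ifs at h <;> omega

theorem skip_lt {σ : ℕ → Option ℕ} {x u : ℕ} (hu : u < offLength σ x) : skip (σ x) u < x := by
  rw [offLength] at hu
  rcases h : σ x with _ | s
  · simpa [skip, h] using hu
  · rw [h] at hu
    simp only [skip]
    simp at hu
    split_ifs <;> omega

theorem exists_skip_eq {σ : ℕ → Option ℕ} {x j : ℕ} (hσ : ∀ s, σ x = some s → s < x)
    (hj : j < x) (h : σ x ≠ some j) : ∃ u < offLength σ x, skip (σ x) u = j := by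
  rcases hs : σ x with _ | s
  · exact ⟨j, by simpa [offLength, hs] using hj, rfl⟩
  · have := hσ s hs
    have hne : s ≠ j := by rintro rfl; exact h hs
    simp only [offLength, hs, Option.toList_some, List.length_singleton, skip]
    rcases lt_or_ge j s with h1 | h1
    · exact ⟨j, by omega, if_pos h1⟩
    · exact ⟨j - 1, by omega, by rw [if_neg (by omega)]; omega⟩

theorem roundRow_lt {σ : ℕ → Option ℕ} {x : ℕ} (hσ : ∀ s, σ x = some s → s < x) :
    ∀ {k : Option (ℕ × Bool)} {j : ℕ}, roundRow σ k x = some j → j < x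
  | none, j, h => hσ j h
  | some (t, false), j, h => by
    simp only [roundRow] at h
    split_ifs at h with h'
    rw [← Option.some.inj h]
    exact skip_lt (by omega)
  | some (t, true), j, h => by
    simp only [roundRow] at h
    split_ifs at h with h'
    rw [← Option.some.inj h]
    exact skip_lt (by omega)

/-- Among n remaining vertices, the one at u is topmost in round u if 2u + 1 ≤ n (the middle
included), and otherwise lowest in round n - 1 - u. -/
theorem exists_roundRow_eq {σ : ℕ → Option ℕ} {x j : ℕ} (hσ : ∀ s, σ x = some s → s < x)
    (hj : j < x) : σ x = some j ∨ ∃ t < x, ∃ b, roundRow σ (some (t, b)) x = some j := by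
  by_cases h : σ x = some j
  · exact Or.inl h
  · right
    obtain ⟨u, hu, rfl⟩ := exists_skip_eq hσ hj h
    have hle : offLength σ x ≤ x := Nat.sub_le _ _
    rcases le_or_gt (2 * u + 1) (offLength σ x) with h1 | h1
    · exact ⟨u, by omega, false, by simp only [roundRow, if_pos h1]⟩
    · refine ⟨offLength σ x - 1 - u, by omega, true, ?_⟩
      simp only [roundRow]
      rw [if_pos (by omega)]
      congr 2
      omega

theorem roundRow_inj {σ : ℕ → Option ℕ} {x j : ℕ} {k k' : Option (ℕ × Bool)}
    (h : roundRow σ k x = some j) (h' : roundRow σ k' x = some j) : k = k' := by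
  have key : ∀ t b, roundRow σ (some (t, b)) x = some j → ∃ u, skip (σ x) u = j ∧
      u < offLength σ x ∧ u = (if b then offLength σ x - 1 - t else t) ∧
      2 * t + 1 + b.toNat ≤ offLength σ x := by
    intro t b h
    cases b <;> simp only [roundRow] at h <;> split_ifs at h with h1 <;>
      exact ⟨_, Option.some.inj h, by omega, by simp, by simp; omega⟩
  rcases k with _ | ⟨t, b⟩ <;> rcases k' with _ | ⟨t', b'⟩
  · rfl
  · obtain ⟨u, hu, -⟩ := key _ _ h'
    simp only [roundRow] at h
    rw [h] at hu
    exact absurd hu (skip_ne _ _)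
  · obtain ⟨u, hu, -⟩ := key _ _ h
    simp only [roundRow] at h'
    rw [h'] at hu
    exact absurd hu (skip_ne _ _)
  · obtain ⟨u, hu, h1, h2, h3⟩ := key _ _ h
    obtain ⟨u', hu', h1', h2', h3'⟩ := key _ _ h'
    have h4 := skip_inj (hu.trans hu'.symm)
    cases b <;> cases b' <;> simp at h2 h2' h3 h3' ⊢ <;> omega

theorem roundCtr_lt {c : ℕ} : ∀ {k : Option (ℕ × Bool)} {j : ℕ}, roundCtr c k = some j → j < c
  | none, j, h => by
    simp only [roundCtr] at h
    split_ifs at h with h'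
    obtain ⟨m, rfl⟩ := h'
    have := Option.some.inj h
    omega
  | some (t, false), j, h => by
    simp only [roundCtr] at h
    split_ifs at h with h'
    have := Option.some.inj h
    omega
  | some (t, true), j, h => by
    simp only [roundCtr] at h
    split_ifs at h with h'
    have := Option.some.inj h
    omega

theorem exists_roundCtr_eq {c j : ℕ} (hj : j < c) :
    roundCtr c none = some j ∨ ∃ t < c, ∃ b, roundCtr c (some (t, b)) = some j := by
  rcases lt_trichotomy (2 * j + 1) c with h | h | h
  · exact Or.inr ⟨j, hj, false, if_pos (by omega)⟩
  · refine Or.inl ?_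
    simp only [roundCtr]
    rw [if_pos ⟨j, h.symm⟩]
    congr 1
    omega
  · refine Or.inr ⟨c - 1 - j, by omega, true, ?_⟩
    simp only [roundCtr]
    rw [if_pos (by omega)]
    congr 1
    omega

theorem roundCtr_inj {c j : ℕ} {k k' : Option (ℕ × Bool)}
    (h : roundCtr c k = some j) (h' : roundCtr c k' = some j) : k = k' := by
  rcases k with _ | ⟨t, _ | _⟩ <;> rcases k' with _ | ⟨t', _ | _⟩ <;>
    simp only [roundCtr, Nat.odd_iff] at h h' <;> split_ifs at h h' <;>
    simp only [Option.some.injEq] at h h' <;> simp <;> omega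

/-- Reflection swaps the topmost and lowest central vertices, so rounds through the centre must
exchange their two chains. -/
theorem roundCtr_bar {c : ℕ} {flip : ℕ → Bool} (hflip : ∀ t, 2 * t + 2 ≤ c → flip t = true) :
    ∀ k, roundCtr c (roundBar flip k) = (roundCtr c k).map fun j => c - 1 - j
  | none => by
    simp only [roundBar, roundCtr, Nat.odd_iff]
    split_ifs with h
    · simp; omega
    · rfl
  | some (t, b) => by
    by_cases h : 2 * t + 2 ≤ c
    · cases b <;> simp [roundBar, roundCtr, hflip t h, h]
      omega
    · cases b <;> cases hf : flip t <;> simp [roundBar, roundCtr, h, hf]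

/-- The label of a chain, with the bound on the number of the round forgotten. -/
def roundLabel {N : ℕ} (k : Option (Fin N × Bool)) : Option (ℕ × Bool) :=
  k.map fun k => (k.1.val, k.2)

theorem roundLabel_injective {N : ℕ} : Function.Injective (@roundLabel N) :=
  Option.map_injective fun k k' h => by
    obtain ⟨h1, h2⟩ := Prod.ext_iff.1 h
    exact Prod.ext (Fin.ext h1) h2

/-- The chains drawn in rounds, together with a chain through prescribed rows. -/
def roundSelection (l : List ℕ) (c : ℕ) (σ : ℕ → Option ℕ) (hσ : ∀ x s, σ x = some s → s < x)
    (flip : ℕ → Bool) (hflip : ∀ t, 2 * t + 2 ≤ c → flip t = true) :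
    Selection l c (Option (Fin (2 * l.sum + c) × Bool)) where
  row k := roundRow σ (roundLabel k)
  ctr k := roundCtr c (roundLabel k)
  bar k := k.map fun k => (k.1, k.2 ^^ flip k.1)
  bar_bar k := by rcases k with _ | ⟨t, b⟩ <;> simp
  row_lt k x j h := roundRow_lt (hσ x) h
  row_cover x hx j hj := by
    rcases exists_roundRow_eq (hσ x) hj with h | ⟨t, ht, b, h⟩
    · exact ⟨none, h⟩
    · have := le_sum_of_mem hx
      exact ⟨some (⟨t, by omega⟩, b), h⟩
  row_inj x _ k k' j h h' := roundLabel_injective (roundRow_inj h h')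
  ctr_lt k j h := roundCtr_lt h
  ctr_cover j hj := by
    rcases exists_roundCtr_eq hj with h | ⟨t, ht, b, h⟩
    · exact ⟨none, h⟩
    · exact ⟨some (⟨t, by omega⟩, b), h⟩
  ctr_inj k k' j h h' := roundLabel_injective (roundCtr_inj h h')
  ctr_bar k := by
    rw [← roundCtr_bar hflip]
    rcases k with _ | ⟨t, b⟩ <;> rfl

theorem topmost_columns (s : ℕ) (l : List ℕ) {σ : ℕ → Option ℕ} (hσ : ∀ x s, σ x = some s → s < x)
    {off : List ℕ → List ℕ} (hoff : ∀ v, off v = (σ v.length).elim v fun k => v.eraseIdx k)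
    (t : ℕ) : topmost ((columns s l).map off) t = leftChain s l (roundRow σ (some (t, false))) := by
  rw [topmost, List.filterMap_map]
  refine filterMap_columns fun v => ?_
  simp only [Function.comp_apply, roundRow, offLength, hoff]
  rcases Option.eq_none_or_eq_some (σ v.length) with h | ⟨k, h⟩
  · by_cases h' : 2 * t + 1 ≤ v.length <;> simp [skip, h, h']
  · have hk := hσ _ _ h
    simp only [h, Option.elim_some, List.length_eraseIdx_of_lt hk, Option.toList_some,
      List.length_singleton, skip, List.getElem?_eraseIdx]
    by_cases h' : 2 * t + 1 ≤ v.length - 1 <;> by_cases h'' : t < k <;> simp [h', h'']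

theorem lowest_columns (s : ℕ) (l : List ℕ) {σ : ℕ → Option ℕ} (hσ : ∀ x s, σ x = some s → s < x)
    {off : List ℕ → List ℕ} (hoff : ∀ v, off v = (σ v.length).elim v fun k => v.eraseIdx k)
    (t : ℕ) : lowest ((columns s l).map off) t = leftChain s l (roundRow σ (some (t, true))) := by
  rw [lowest, List.filterMap_map]
  refine filterMap_columns fun v => ?_
  simp only [Function.comp_apply, roundRow, offLength, hoff]
  rcases Option.eq_none_or_eq_some (σ v.length) with h | ⟨k, h⟩
  · by_cases h' : 2 * t + 2 ≤ v.length
    · simp only [h, Option.elim_none, if_pos h', Option.toList_none, List.length_nil, Nat.sub_zero,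
        skip, Option.bind_some]
      rw [List.getElem?_reverse (by omega)]
    · simp [h, h']
  · have hk := hσ _ _ h
    simp only [h, Option.elim_some, List.length_eraseIdx_of_lt hk, Option.toList_some,
      List.length_singleton, skip]
    by_cases h' : 2 * t + 2 ≤ v.length - 1
    · rw [if_pos h', if_pos h', List.getElem?_reverse (by rw [List.length_eraseIdx_of_lt hk]; omega),
        List.length_eraseIdx_of_lt hk, List.getElem?_eraseIdx, Option.bind_some]
      split_ifs <;> rfl
    · simp [h']

theorem getElem?_centre {s c t : ℕ} (ht : 2 * t + 2 ≤ c) {Z : List ℕ}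
    (hZ : Z = if Odd c then (List.range' s c).eraseIdx (c / 2) else List.range' s c) :
    Z[t]? = some (s + t) ∧ Z.reverse[t]? = some (s + (c - 1 - t)) := by
  subst hZ
  have hlen : (List.range' s c).length = c := List.length_range'
  have hget : ∀ i < c, (List.range' s c)[i]? = some (s + i) := by
    intro i hi
    simp [hi]
  split_ifs with hc
  · have hc2 : c / 2 < (List.range' s c).length := by rw [hlen]; omega
    rw [Nat.odd_iff] at hc
    rw [List.getElem?_reverse (by rw [List.length_eraseIdx_of_lt hc2, hlen]; omega),
      List.length_eraseIdx_of_lt hc2, hlen, List.getElem?_eraseIdx, List.getElem?_eraseIdx,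
      if_pos (by omega), if_neg (by omega), hget _ (by omega), hget _ (by omega)]
    exact ⟨rfl, by congr 2; omega⟩
  · rw [List.getElem?_reverse (by rw [hlen]; omega), hlen, hget _ (by omega), hget _ (by omega)]
    exact ⟨rfl, rfl⟩

section

variable {l : List ℕ} {c : ℕ} {σ : ℕ → Option ℕ} {hσ : ∀ x s, σ x = some s → s < x}
  {flip : ℕ → Bool} {hflip : ∀ t, 2 * t + 2 ≤ c → flip t = true}

theorem roundSelection_bar_some (t : Fin (2 * l.sum + c)) (b : Bool) :
    (roundSelection l c σ hσ flip hflip).bar (some (t, b)) = some (t, b ^^ flip t) := rfl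

/-- Consequently the two chains of a round differ, on the left, exactly in columns with one vertex
remaining. -/
theorem isSome_roundSelection_row (t : Fin (2 * l.sum + c)) (b : Bool) (x : ℕ) :
    ((roundSelection l c σ hσ flip hflip).row (some (t, b)) x).isSome ↔
      2 * t.val + 1 + b.toNat ≤ offLength σ x := by
  change (roundRow σ (some (t.val, b)) x).isSome ↔ _
  cases b <;> simp only [roundRow] <;> split_ifs <;> simp <;> omega

theorem isSome_roundSelection_ctr (t : Fin (2 * l.sum + c)) (b : Bool) :
    ((roundSelection l c σ hσ flip hflip).ctr (some (t, b))).isSome ↔ 2 * t.val + 2 ≤ c := by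
  change (roundCtr c (some (t.val, b))).isSome ↔ _
  cases b <;> simp only [roundCtr] <;> split_ifs <;> simp_all

/-- Later rounds visit fewer columns. Within a round, either the two chains are mirror images, a
pair not considered here, or the lowest chain is nested in the topmost one. Only the comparison with
the chain `none` depends on the diagram. -/
theorem roundSelection_nested
    (h : ∀ t b, (roundSelection l c σ hσ flip hflip).Nested none (some (t, b)) ∨
      (roundSelection l c σ hσ flip hflip).Nested (some (t, b)) none)
    (k k' : Option (Fin (2 * l.sum + c) × Bool))
    (hk : k' ≠ (roundSelection l c σ hσ flip hflip).bar k) :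
    (roundSelection l c σ hσ flip hflip).Nested k k' ∨
      (roundSelection l c σ hσ flip hflip).Nested k' k := by
  have key : ∀ (t t' : Fin (2 * l.sum + c)) (b b' : Bool),
      (t < t' ∨ t = t' ∧ (b = b' ∨ flip t = false ∧ b = false)) →
      (roundSelection l c σ hσ flip hflip).Nested (some (t', b')) (some (t, b)) := by
    intro t t' b b' h
    refine ⟨fun x _ => ?_, ?_, fun x _ => ?_⟩
    · rw [isSome_roundSelection_row, isSome_roundSelection_row]
      rcases h with h | ⟨rfl, rfl | ⟨-, rfl⟩⟩
      · have := Bool.toNat_lt b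
        omega
      · exact id
      · rw [Bool.toNat_false]
        omega
    · rw [isSome_roundSelection_ctr, isSome_roundSelection_ctr]
      omega
    · rw [roundSelection_bar_some, roundSelection_bar_some, isSome_roundSelection_row,
        isSome_roundSelection_row]
      rcases h with h | ⟨rfl, rfl | ⟨h, rfl⟩⟩
      · have := Bool.toNat_lt (b ^^ flip t)
        omega
      · exact id
      · rw [h, Bool.xor_false, Bool.xor_false, Bool.toNat_false]
        omega
  rcases k with _ | ⟨t, b⟩ <;> rcases k' with _ | ⟨t', b'⟩
  · exact absurd rfl hk
  · exact h t' b'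
  · exact (h t b).symm
  · rw [roundSelection_bar_some] at hk
    rcases lt_trichotomy t t' with h | rfl | h
    · exact Or.inr (key _ _ _ _ (Or.inl h))
    · rcases hf : flip t
      · cases b
        · exact Or.inr (key _ _ _ _ (Or.inr ⟨rfl, Or.inr ⟨hf, rfl⟩⟩))
        · have hb : b' = false := by
            by_contra hb
            exact hk (by simp [hf, Bool.eq_true_of_not_eq_false hb])
          subst hb
          exact Or.inl (key _ _ _ _ (Or.inr ⟨rfl, Or.inr ⟨hf, rfl⟩⟩))
      · have hb : b' = b := by
          by_contra hb
          refine hk ?_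
          rw [hf, Bool.xor_true, ← Bool.eq_not.2 hb]
        exact Or.inl (key _ _ _ _ (Or.inr ⟨rfl, Or.inl hb⟩))
    · exact Or.inl (key _ _ _ _ (Or.inl h))

theorem roundSelection_chains {off : List ℕ → List ℕ}
    (hoff : ∀ v, off v = (σ v.length).elim v fun k => v.eraseIdx k) {Z : List ℕ}
    (hZ : Z = if Odd c then (List.range' (l.sum + 1) c).eraseIdx (c / 2)
      else List.range' (l.sum + 1) c) (t : Fin (2 * l.sum + c)) :
    [(roundSelection l c σ hσ flip hflip).chain (some (t, false)),
      (roundSelection l c σ hσ flip hflip).chain (some (t, true))] =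
      if 2 * t.val + 2 ≤ c then throughCentre (2 * l.sum + c) ((columns 1 l).map off) Z t
      else if flip t then acrossCentre (2 * l.sum + c) ((columns 1 l).map off) t
      else [topmost ((columns 1 l).map off) t ++
          mirror (2 * l.sum + c) (topmost ((columns 1 l).map off) t),
        lowest ((columns 1 l).map off) t ++
          mirror (2 * l.sum + c) (lowest ((columns 1 l).map off) t)] := by
  have hrow : ∀ b, (roundSelection l c σ hσ flip hflip).row (some (t, b)) =
      roundRow σ (some (t.val, b)) := fun b => rfl
  have hctr : ∀ b, (roundSelection l c σ hσ flip hflip).ctr (some (t, b)) =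
      roundCtr c (some (t.val, b)) := fun b => rfl
  simp only [Selection.chain, roundSelection_bar_some, hrow, hctr, throughCentre, acrossCentre,
    topmost_columns 1 l hσ hoff, lowest_columns 1 l hσ hoff, roundCtr]
  by_cases h : 2 * t.val + 2 ≤ c
  · obtain ⟨h1, h2⟩ := getElem?_centre h hZ
    simp [h, h1, h2, hflip _ h]
  · rcases hf : flip t <;> simp [h]

theorem isRichardson_rounds {τ : Family} (hN : τ = .sp → Even c) {off : List ℕ → List ℕ}
    (hoff : ∀ v, off v = (σ v.length).elim v fun k => v.eraseIdx k) {Z : List ℕ}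
    (hZ : Z = if Odd c then (List.range' (l.sum + 1) c).eraseIdx (c / 2)
      else List.range' (l.sum + 1) c)
    (hchains : chains τ l (some c) =
      (if Odd c then [(roundSelection l c σ hσ flip hflip).chain none] else []) ++
        (List.range (2 * l.sum + c)).flatMap fun t =>
          if 2 * t + 2 ≤ c then throughCentre (2 * l.sum + c) ((columns 1 l).map off) Z t
          else if flip t then acrossCentre (2 * l.sum + c) ((columns 1 l).map off) t
          else [topmost ((columns 1 l).map off) t ++
              mirror (2 * l.sum + c) (topmost ((columns 1 l).map off) t),
            lowest ((columns 1 l).map off) t ++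
              mirror (2 * l.sum + c) (lowest ((columns 1 l).map off) t)])
    (hspine : ¬ Odd c → ∀ x, σ x = none) (hso : τ = .so → ∀ t, flip t = true)
    (hnest : ∀ t b, (roundSelection l c σ hσ flip hflip).Nested none (some (t, b)) ∨
      (roundSelection l c σ hσ flip hflip).Nested (some (t, b)) none)
    (hself : ∀ t, flip t = true → (∀ x ∈ l, offLength σ x ≠ 2 * t + 1) ∨
      ∃ x₀, l.count x₀ = 1 ∧ (∀ x ∈ l, x ≠ x₀ → offLength σ x ≠ 2 * t + 1) ∧
        offLength σ x₀ = 2 * t + 1 ∧ (2 * t + 2 ≤ c ↔ τ = .sp)) :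
    IsRichardson τ (dimVector l (some c)) (lineMatrix τ l (some c)) ∧
      Module.finrank ℂ (centralizer τ (lineMatrix τ l (some c))) =
        Module.finrank ℂ (leviFactor τ (dimVector l (some c))) := by
  -- For even `c` the label `none` stands for no chain of the diagram.
  have hnone : ¬ Odd c → (roundSelection l c σ hσ flip hflip).chain none = [] := by
    intro hc
    have h1 : leftChain 1 l ((roundSelection l c σ hσ flip hflip).row none) = [] := by
      change leftChain 1 l σ = []
      simp [leftChain, hspine hc]
    have h2 : (roundSelection l c σ hσ flip hflip).ctr none = none := if_neg hc
    have h3 : (roundSelection l c σ hσ flip hflip).bar none = none := rfl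
    rw [Selection.chain, h3, h1, h2]
    rfl
  refine Selection.isRichardson_lineMatrix (c := some c) (roundSelection l c σ hσ flip hflip)
    (fun hτ => even_sum_dimVector (hN hτ)) (mem_diagramLines_iff (fun k => ?_) fun L hL => ?_)
    ?_ (roundSelection_nested hnest) ?_
  · rw [hchains, List.mem_append]
    rcases k with _ | ⟨t, b⟩
    · by_cases hc : Odd c
      · exact Or.inl (Or.inl (by simp [hc]))
      · exact Or.inr (hnone hc)
    · refine Or.inl (Or.inr (List.mem_flatMap.2 ⟨t, List.mem_range.2 t.isLt, ?_⟩))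
      rw [← roundSelection_chains (hσ := hσ) (hflip := hflip) hoff hZ t]
      cases b <;> simp
  · rw [hchains, List.mem_append] at hL
    rcases hL with hL | hL
    · split_ifs at hL
      · exact ⟨none, (List.mem_singleton.1 hL).symm⟩
      · simp at hL
    · obtain ⟨t, ht, hL⟩ := List.mem_flatMap.1 hL
      have h1 := roundSelection_chains (hσ := hσ) (hflip := hflip) hoff hZ
        ⟨t, List.mem_range.1 ht⟩
      rw [← h1] at hL
      rcases List.mem_pair.1 hL with rfl | rfl <;> exact ⟨_, rfl⟩
  · rintro hτ (_ | ⟨t, b⟩) hk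
    · by_cases hc : Odd c
      · right
        have h2 : (roundSelection l c σ hσ flip hflip).ctr none = some (c / 2) := if_pos hc
        rw [h2]
        rfl
      · exact Or.inl (hnone hc)
    · rw [roundSelection_bar_some, hso hτ] at hk
      cases b <;> simp at hk
  · rintro (_ | ⟨t, b⟩)
    · exact Or.inl fun _ _ => rfl
    · rw [roundSelection_bar_some]
      rcases hf : flip t
      · exact Or.inl fun _ _ => by rw [Bool.xor_false]
      · have key : ∀ x, ((roundSelection l c σ hσ flip hflip).row (some (t, b)) x).isSome =
            ((roundSelection l c σ hσ flip hflip).row (some (t, b ^^ true)) x).isSome ↔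
              offLength σ x ≠ 2 * t.val + 1 := by
          intro x
          rw [Bool.eq_iff_iff, isSome_roundSelection_row, isSome_roundSelection_row]
          cases b <;> simp <;> omega
        simp only [Ne, key, not_not]
        rcases hself t hf with h | ⟨x₀, h1, h2, h3, h4⟩
        · exact Or.inl h
        · exact Or.inr ⟨x₀, h1, h2, h3, by rw [isSome_roundSelection_ctr, h4]⟩

end

/-! ### The symplectic and orthogonal diagrams with a central column. -/

theorem isRichardson_oddSp {l : List ℕ} {c : ℕ} (h : IsSimple .sp l (some c)) :
    IsRichardson .sp (dimVector l (some c)) (lineMatrix .sp l (some c)) ∧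
      Module.finrank ℂ (centralizer .sp (lineMatrix .sp l (some c))) =
        Module.finrank ℂ (leviFactor .sp (dimVector l (some c))) := by
  obtain ⟨hc, h⟩ := h
  have hc' : ¬ Odd c := Nat.not_odd_iff_even.2 hc
  refine isRichardson_rounds (σ := fun _ => none) (hσ := fun _ _ h => by simp at h)
    (flip := fun t => decide (2 * t + 2 ≤ c) || !decide (∃ x ∈ l, x = 2 * t + 1))
    (hflip := fun t ht => by simp [ht]) (fun _ => hc) (off := id) (fun v => rfl)
    (Z := List.range' (l.sum + 1) c) (by rw [if_neg hc']) ?_ (fun _ _ => rfl) (by simp) ?_ ?_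
  · rw [if_neg hc', List.nil_append, List.map_id]
    simp only [chains, oddSp]
    congr 1
    ext1 t
    by_cases h1 : 2 * t + 2 ≤ c
    · simp only [h1, if_true]
    · by_cases h2 : ∃ x ∈ l, x = 2 * t + 1
      · simp only [h1, h2, if_true, if_false]
        simp
      · simp only [h1, h2, if_false]
        simp
  · intro t b
    left
    refine ⟨fun x _ hx => (by cases hx), fun hx => ?_, fun x _ hx => (by cases hx)⟩
    change (roundCtr c none).isSome = true at hx
    simp [roundCtr, hc'] at hx
  · intro t ht
    have hoff : ∀ x, offLength (fun _ => none) x = x := fun x => rfl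
    simp only [hoff]
    by_cases hx : 2 * t + 1 ∈ l
    · right
      -- A flipped round with a single-vertex column must still reach the centre. The odd length 2t
      -- + 1 is then below `c`, so simplicity makes it occur once on the left.
      have h1 : 2 * t + 2 ≤ c := by
        by_contra h1
        simp [h1, hx] at ht
      refine ⟨2 * t + 1, ?_, fun x _ hx => hx, rfl, by simp [h1]⟩
      have h2 := h (2 * t + 1) (by simp [dimVector, hx]) ⟨t, rfl⟩ (by omega)
      have h3 : c ≠ 2 * t + 1 := by omega
      simp only [dimVector, Option.toList_some, List.count_append, List.count_reverse,
        List.count_singleton, beq_iff_eq, if_neg h3] at h2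
      omega
    · exact Or.inl fun x hx' hx0 => hx (hx0 ▸ hx')

theorem spineRow_lt {l : List ℕ} {c x s : ℕ} (h : spineRow l c x = some s) : s < x := by
  rw [spineRow] at h
  split_ifs at h with h1 h2 h2
  · have := Option.some.inj h
    omega
  · have := Option.some.inj h
    obtain ⟨m, rfl⟩ := h2
    omega

theorem isSome_spineRow_of_exists {l : List ℕ} {c : ℕ} (h : ∃ y ∈ l, Even y ∧ c < y) (x : ℕ) :
    (spineRow l c x).isSome ↔ c < x := by
  rw [spineRow, if_pos h]
  split_ifs with h' <;> simp [h']

theorem isSome_spineRow_of_not_exists {l : List ℕ} {c : ℕ} (h : ¬ ∃ y ∈ l, Even y ∧ c < y)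
    (x : ℕ) : (spineRow l c x).isSome ↔ x % 2 = 1 := by
  rw [spineRow, if_neg h, ← Nat.odd_iff]
  split_ifs with h' <;> simp only [h'] <;> simp

theorem offLength_spineRow_of_exists {l : List ℕ} {c : ℕ} (h : ∃ y ∈ l, Even y ∧ c < y) (x : ℕ) :
    offLength (spineRow l c) x = if c < x then x - 1 else x := by
  rw [offLength, spineRow, if_pos h]
  split_ifs <;> rfl

theorem offLength_spineRow_of_not_exists {l : List ℕ} {c : ℕ}
    (h : ¬ ∃ y ∈ l, Even y ∧ c < y) (x : ℕ) :
    offLength (spineRow l c) x = if x % 2 = 1 then x - 1 else x := by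
  rw [offLength, spineRow, if_neg h]
  simp only [Nat.odd_iff]
  split_ifs <;> rfl

theorem offSpine_eq (l : List ℕ) (c : ℕ) (v : List ℕ) :
    offSpine l c v = (spineRow l c v.length).elim v fun k => v.eraseIdx k := by
  rw [offSpine]
  cases spineRow l c v.length <;> rfl

theorem oddSo_of_even {l : List ℕ} {c : ℕ} (hc : ¬ Odd c) : oddSo l c =
    oddSoRounds (2 * l.sum + c) (columns 1 l) (List.range' (l.sum + 1) c) := by
  simp only [oddSo, if_neg hc]

/-- All lengths are even, so no column is ever left with exactly one vertex, and a chain and its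
mirror image visit the same columns. -/
theorem isRichardson_oddSo_of_even {l : List ℕ} {c : ℕ} (h : IsSimple .so l (some c))
    (hc : ¬ Odd c) :
    IsRichardson .so (dimVector l (some c)) (lineMatrix .so l (some c)) ∧
      Module.finrank ℂ (centralizer .so (lineMatrix .so l (some c))) =
        Module.finrank ℂ (leviFactor .so (dimVector l (some c))) := by
  obtain ⟨e, o, rfl, he, -, -, -, ho⟩ := h
  obtain rfl := ho.resolve_left hc
  rw [List.append_nil] at *
  refine isRichardson_rounds (σ := fun _ => none) (hσ := fun _ _ h => by simp at h)
    (flip := fun _ => true) (hflip := fun _ _ => rfl) (by simp) (off := id) (fun v => rfl)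
    (Z := List.range' (e.sum + 1) c) (by rw [if_neg hc]) ?_ (fun _ _ => rfl) (by simp) ?_ ?_
  · rw [if_neg hc, List.nil_append, List.map_id]
    simp only [chains, oddSo_of_even hc, oddSoRounds, List.length_range', if_true]
  · intro t b
    left
    refine ⟨fun x _ hx => (by cases hx), fun hx => ?_, fun x _ hx => (by cases hx)⟩
    change (roundCtr c none).isSome = true at hx
    simp [roundCtr, hc] at hx
  · refine fun t _ => Or.inl fun x hx hx0 => ?_
    change x = 2 * t + 1 at hx0
    obtain ⟨m, hm⟩ := he x hx
    omega

/-- Removing the spine leaves an even number of vertices in every left column, except in even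
columns longer than `c` when these exist; their lengths have multiplicity one. -/
theorem isRichardson_oddSo_of_odd {l : List ℕ} {c : ℕ} (h : IsSimple .so l (some c))
    (hc : Odd c) :
    IsRichardson .so (dimVector l (some c)) (lineMatrix .so l (some c)) ∧
      Module.finrank ℂ (centralizer .so (lineMatrix .so l (some c))) =
        Module.finrank ℂ (leviFactor .so (dimVector l (some c))) := by
  have hc2 : c % 2 = 1 := Nat.odd_iff.1 hc
  obtain ⟨e, o, hl, he, ho, heo, hcount, -⟩ := h
  have hmem : ∀ x ∈ l, (x ∈ e ∧ x % 2 = 0) ∨ (x ∈ o ∧ x % 2 = 1) := by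
    intro x hx
    rw [hl, List.mem_append] at hx
    exact hx.imp (fun hx => ⟨hx, Nat.even_iff.1 (he x hx)⟩) fun hx => ⟨hx, Nat.odd_iff.1 (ho x hx)⟩
  have hxodd : (∃ y ∈ l, Even y ∧ c < y) → ∀ x ∈ l, x % 2 = 1 → c < x := by
    rintro ⟨y, hy, hy2, hyc⟩ x hx hx2
    have hye := ((hmem y hy).resolve_right (by have := Nat.even_iff.1 hy2; omega)).1
    have hxo := ((hmem x hx).resolve_left (by omega)).1
    exact hyc.trans (heo y hye x hxo)
  have hlt : c / 2 < c := by omega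
  have hZ : (List.range' (l.sum + 1) c)[c / 2]? = some (l.sum + 1 + c / 2) := by simp [hlt]
  refine isRichardson_rounds (σ := spineRow l c) (hσ := fun _ _ h => spineRow_lt h)
    (flip := fun _ => true) (hflip := fun _ _ => rfl) (by simp) (off := offSpine l c)
    (offSpine_eq l c)
    (Z := (List.range' (l.sum + 1) c).eraseIdx (c / 2)) (by rw [if_pos hc]) ?_
    (fun h => absurd hc h) (by simp) ?_ ?_
  · have hS : (columns 1 l).filterMap (spineVertex l c) = leftChain 1 l (spineRow l c) :=
      filterMap_columns fun v => rfl
    have hlen : ((List.range' (l.sum + 1) c).eraseIdx (c / 2)).length = c - 1 := by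
      rw [List.length_eraseIdx_of_lt (by rw [List.length_range']; exact hlt), List.length_range']
    have hchain : ∀ h h', (roundSelection l c (spineRow l c) h (fun _ => true) h').chain none =
        leftChain 1 l (spineRow l c) ++ [l.sum + 1 + c / 2] ++
          mirror (2 * l.sum + c) (leftChain 1 l (spineRow l c)) := by
      intro h h'
      change leftChain 1 l (spineRow l c) ++ (Option.map _ (roundCtr c none)).toList ++
        mirror (2 * l.sum + c) (leftChain 1 l (spineRow l c)) = _
      simp [roundCtr, hc]
    simp only [chains, oddSo, if_pos hc, hS, hZ, hchain, oddSoRounds, hlen, Option.toList_some,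
      List.singleton_append, if_true]
    congr 2
    ext1 t
    -- As `c` is odd, deleting the middle vertex does not change the number of rounds through the
    -- centre.
    have : 2 * t + 2 ≤ c - 1 ↔ 2 * t + 2 ≤ c := by omega
    simp only [this]
  · intro t b
    have hctr : ((roundSelection l c (spineRow l c) (fun _ _ h => spineRow_lt h)
        (fun _ => true) (fun _ _ => rfl)).ctr none).isSome := by
      change (roundCtr c none).isSome = true
      simp [roundCtr, hc]
    -- Either both chains of round t visit the centre and every column on the spine, or they visit
    -- no left column off the spine; each alternative gives nesting in one direction.
    have hclaim : (2 * t.val + 2 ≤ c ∧ ∀ x ∈ l, (spineRow l c x).isSome →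
        2 * t.val + 2 ≤ offLength (spineRow l c) x) ∨
        ∀ x ∈ l, 2 * t.val + 1 ≤ offLength (spineRow l c) x → (spineRow l c x).isSome := by
      by_cases hbig : ∃ y ∈ l, Even y ∧ c < y
      · simp only [isSome_spineRow_of_exists hbig, offLength_spineRow_of_exists hbig]
        by_cases ht : 2 * t.val + 2 ≤ c
        · refine Or.inl ⟨ht, fun x _ hx => ?_⟩
          rw [if_pos hx]
          omega
        · refine Or.inr fun x hx h => ?_
          by_contra hxc
          rw [if_neg hxc] at h
          -- Here c ≤ 2t + 1 ≤ x ≤ c, so x = c is odd, although odd lengths exceed `c`.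
          have := hxodd hbig x hx
          omega
      · simp only [isSome_spineRow_of_not_exists hbig, offLength_spineRow_of_not_exists hbig]
        -- Such an even length satisfies 2t + 2 ≤ x ≤ c, and odd lengths exceed x, so odd columns
        -- keep at least 2t + 2 vertices off the spine.
        by_cases hx : ∃ x ∈ l, x % 2 = 0 ∧ 2 * t.val + 1 ≤ x
        · obtain ⟨x, hx, hx2, hxt⟩ := hx
          have hxc : ¬ c < x := fun h => hbig ⟨x, hx, Nat.even_iff.2 hx2, h⟩
          refine Or.inl ⟨by omega, fun y hy hy2 => ?_⟩
          rw [if_pos hy2]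
          have hxe := ((hmem x hx).resolve_right (by omega)).1
          have hyo := ((hmem y hy).resolve_left (by omega)).1
          have := heo x hxe y hyo
          omega
        · refine Or.inr fun x hx' h => ?_
          by_contra hx2
          rw [if_neg hx2] at h
          exact hx ⟨x, hx', by omega, h⟩
    rcases hclaim with ⟨ht, h⟩ | h
    · left
      refine ⟨fun x hx hx' => ?_, fun _ => (isSome_roundSelection_ctr _ _).2 ht, fun x hx hx' => ?_⟩
      · have := h x hx hx'
        have := Bool.toNat_lt b
        exact (isSome_roundSelection_row _ _ _).2 (by omega)
      · have := h x hx hx'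
        have := Bool.toNat_lt (b ^^ true)
        exact (isSome_roundSelection_row t (b ^^ true) _).2 (by omega)
    · right
      refine ⟨fun x hx hx' => h x hx ?_, fun _ => hctr, fun x hx hx' => h x hx ?_⟩
      · have := (isSome_roundSelection_row _ _ _).1 hx'
        omega
      · have := (isSome_roundSelection_row t (b ^^ true) _).1 hx'
        omega
  · intro t _
    by_cases hbig : ∃ y ∈ l, Even y ∧ c < y
    · simp only [offLength_spineRow_of_exists hbig]
      have key : ∀ x ∈ l, (if c < x then x - 1 else x) = 2 * t + 1 → x = 2 * t + 2 ∧ c < x := by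
        intro x hx h
        have := hxodd hbig x hx
        split_ifs at h <;> omega
      -- The only source of a single remaining vertex is the even length 2t + 2 > c, in a round that
      -- misses the centre, as the orthogonal criterion demands.
      by_cases hx : 2 * t + 2 ∈ l ∧ c < 2 * t + 2
      · refine Or.inr ⟨2 * t + 2, ?_, fun x hx' hne h => hne (key x hx' h).1, ?_, ?_⟩
        · have he' := ((hmem _ hx.1).resolve_right (by omega)).1
          have ho' : 2 * t + 2 ∉ o := fun h => by
            have := Nat.odd_iff.1 (ho _ h)
            omega
          rw [hl, List.count_append, hcount _ he' hx.2, List.count_eq_zero.2 ho']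
        · rw [if_pos hx.2]
          rfl
        · simp only [reduceCtorEq, iff_false]
          omega
      · refine Or.inl fun x hx' h => ?_
        obtain ⟨rfl, h2⟩ := key x hx' h
        exact hx ⟨hx', h2⟩
    · simp only [offLength_spineRow_of_not_exists hbig]
      refine Or.inl fun x _ h => ?_
      split_ifs at h <;> omega

end LineDiagram

theorem mainTheorem1 (τ : LineDiagram.Family) (l : List ℕ) (c : Option ℕ)
    (hpos : ∀ x ∈ LineDiagram.dimVector l c, 0 < x) (hsimple : LineDiagram.IsSimple τ l c) :
    LineDiagram.IsRichardson τ (LineDiagram.dimVector l c) (LineDiagram.lineMatrix τ l c) ∧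
      Module.finrank ℂ (LineDiagram.centralizer τ (LineDiagram.lineMatrix τ l c)) =
        Module.finrank ℂ (LineDiagram.leviFactor τ (LineDiagram.dimVector l c)) := by
  rcases τ with _ | _ <;> rcases c with _ | c
  · exact LineDiagram.isRichardson_evenSp l
  · exact LineDiagram.isRichardson_oddSp hsimple
  · exact LineDiagram.isRichardson_evenSo hsimple
  · by_cases hc : Odd c
    · exact LineDiagram.isRichardson_oddSo_of_odd hsimple hc
    · exact LineDiagram.isRichardson_oddSo_of_even hsimple hc
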